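/- Let $d\ge 1$, let $Q=[0,1)^d$ be the unit cell and write $\langle\cdot\rangle=\int_Q\cdot\,dx$. Let $A:\mathbb{R}^d\to\mathcal{M}_d(\mathbb{R})$ be $Q$-periodic (that is, $\mathbb{Z}^d$-periodic), symmetric, uniformly continuous, and coercive with constants $\beta\ge\alpha>0$: for almost every $x\in Q$ and all $\xi\in\mathbb{R}^d$, $|A(x)\xi|\le\beta|\xi|$ and $\xi\cdot A(x)\xi\ge\alpha|\xi|^2$. Let $|A(x)|$ be the operator norm of $A(x)$ on Euclidean space. Let $H^1_{\mathrm{per}}(Q)$ be the space of $Q$-periodic $H^1$ functions, $H^{-1}_{\mathrm{per}}(Q)$ its dual, and $L^2_0(Q)=\{v\in L^2(Q):\langle v\rangle=0\}$. (i) For every $\xi\in\mathbb{R}^d$ there is a unique $\phi\in H^1_{\mathrm{per}}(Q)$ with $\langle\phi\rangle=0$ that solves $-\nabla\cdot A(\xi+\nabla\phi)=0$ weakly, i.e. $\langle\nabla v\cdot A(\xi+\nabla\phi)\rangle=0$ for all $v\in H^1_{\mathrm{per}}(Q)$; and there is a unique symmetric matrix $A_{\mathrm{hom}}$ such that $\xi\cdot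 A_{\mathrm{hom}}\xi=\langle(\xi+\nabla\phi)\cdot A(\xi+\nabla\phi)\rangle$ for all $\xi\in\mathbb{R}^d$. (ii) Let $\mathcal{L}=-\nabla\cdot A\nabla$ with periodic boundary conditions, and let $\mathcal{L}^{-1}$ be its inverse on $L^2_0(Q)$. There are an orthonormal basis $(\psi_i)_{i\ge1}$ of $L^2_0(Q)$, with $\psi_i\in H^1_{\mathrm{per}}(Q)$, and $\lambda_i>0$ such that $\mathcal{L}^{-1}\psi_i=\lambda_i^{-1}\psi_i$ for all $i$. For $\xi\in\mathbb{R}^d$ let $\mathfrak{d}=\nabla\cdot A\xi\in H^{-1}_{\mathrm{per}}(Q)$, i.e. $\langle\mathfrak{d},v\rangle=-\int_Q A\xi\cdot\nabla v\,dx$, and, for any basis as in (ii), let $$e_{\mathfrak{d}}=\sum_{i\ge1}\langle\mathfrak{d},\psi_i\rangle^2\,\delta_{\lambda_i}$$ be the spectral measure of $\mathcal{L}$ projected on $\mathfrak{d}$. For $k\in\mathbb{N}=\{0,1,2,\dots\}$ and $\mu>0$ let $$P_k(\mu,\lambda)=\lambda^{-1}\Big((\mu+\lambda)^2(2\mu+\lambda)^2\cdots(2^{k-1}\mu+\lambda)^2-2^{k(k-1)}\mu^{2k}\Big),$$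 which is a polynomial. (iii) There is a unique symmetric matrix $A_{\mu,k}$ such that for all $\xi\in\mathbb{R}^d$ the following integral converges and $$\xi\cdot A_{\mu,k}\xi=\langle\xi\cdot A\xi\rangle-\int_{\mathbb{R}^+}\frac{P_k(\mu,\lambda)}{(\mu+\lambda)^2(2\mu+\lambda)^2\cdots(2^{k-1}\mu+\lambda)^2}\,de_{\mathfrak{d}}(\lambda).$$ (iv) For all $k\in\mathbb{N}$, all $\mu>0$ and all $\xi\in\mathbb{R}^d$ with $|\xi|=1$, the systematic error satisfies $$0\le\xi\cdot(A_{\mu,k}-A_{\mathrm{hom}})\xi\le 2^{k(k-1)}\,\frac{\langle|A|^2\rangle}{\alpha}\Big(\frac{1}{4\alpha\pi^2}\Big)^{2k}\mu^{2k}.$$ -/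

import Mathlib

open MeasureTheory
open scoped InnerProductSpace

namespace PeriodicHom

/-- The Euclidean space `ℝ^d`. -/
abbrev Space (d : ℕ) : Type := EuclideanSpace ℝ (Fin d)

/-- The periodic cell `Q = [0,1)^d`. -/
def cell (d : ℕ) : Set (Space d) := {x | ∀ i, x i ∈ Set.Ico (0 : ℝ) 1}

/-- Lebesgue measure on the cell `Q`. Since `|Q| = 1`, the integral against it is the average
`⟨·⟩` on the periodic cell. -/
noncomputable def cellMeasure (d : ℕ) : Measure (Space d) := volume.restrict (cell d)

/-- `Q`-periodicity, that is, invariance under translation by `ℤ^d`. -/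
def IsPeriodic {d : ℕ} {β : Type*} (f : Space d → β) : Prop :=
  ∀ (n : Fin d → ℤ) (x : Space d), f (x + WithLp.toLp 2 (fun i => (n i : ℝ))) = f x

/-- A matrix seen as an operator on Euclidean space; its norm is the (operator) norm `|M|`. -/
noncomputable def act {d : ℕ} (M : Matrix (Fin d) (Fin d) ℝ) : Space d →L[ℝ] Space d :=
  Matrix.toEuclideanCLM (n := Fin d) (𝕜 := ℝ) M

/-- `A` is a `Q`-periodic symmetric diffusion matrix, uniformly continuous and coercive with
constants `β ≥ α > 0`. -/
structure IsPeriodicDiffusion {d : ℕ} (A : Space d → Matrix (Fin d) (Fin d) ℝ)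
    (α β : ℝ) : Prop where
  alpha_pos : 0 < α
  alpha_le_beta : α ≤ β
  periodic : IsPeriodic A
  symm : ∀ x, (A x).IsSymm
  uniformContinuous : UniformContinuous A
  bounded : ∀ᵐ x ∂cellMeasure d, ∀ ξ : Space d, ‖act (A x) ξ‖ ≤ β * ‖ξ‖
  coercive : ∀ᵐ x ∂cellMeasure d, ∀ ξ : Space d, α * ‖ξ‖ ^ 2 ≤ ⟪ξ, act (A x) ξ⟫_ℝ

/-- `L²(Q)`. -/
abbrev L2 (d : ℕ) : Type := Lp ℝ 2 (cellMeasure d)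

/-- `L²(Q; ℝ^d)`. -/
abbrev L2Vec (d : ℕ) : Type := Lp (Space d) 2 (cellMeasure d)

/-- `g` is the weak gradient of `u` as a periodic function: integration by parts on `Q` against
all smooth `Q`-periodic test functions, without boundary term. -/
def IsWeakGradient {d : ℕ} (u : L2 d) (g : L2Vec d) : Prop :=
  ∀ χ : Space d → ℝ, ContDiff ℝ ((⊤ : ℕ∞) : WithTop ℕ∞) χ → IsPeriodic χ → ∀ w : Space d,
    ∫ x, u x * fderiv ℝ χ x w ∂cellMeasure d = - ∫ x, ⟪g x, w⟫_ℝ * χ x ∂cellMeasure d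

theorem isCompact_box (d : ℕ) :
    IsCompact (WithLp.toLp 2 '' (Set.pi Set.univ fun _ : Fin d => Set.Icc (0 : ℝ) 1)) :=
  (isCompact_univ_pi fun _ => isCompact_Icc).image (PiLp.continuous_toLp 2 _)

theorem cell_subset (d : ℕ) :
    cell d ⊆ WithLp.toLp 2 '' (Set.pi Set.univ fun _ : Fin d => Set.Icc (0 : ℝ) 1) :=
  fun x hx => ⟨WithLp.ofLp x, fun i _ => Set.Ico_subset_Icc_self (hx i), rfl⟩

theorem measurableSet_cell (d : ℕ) : MeasurableSet (cell d) := by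
  have h : cell d = ⋂ i, (fun x : Space d => x i) ⁻¹' Set.Ico (0 : ℝ) 1 := by
    ext x
    simp [cell]
  rw [h]
  exact MeasurableSet.iInter fun i =>
    (by fun_prop : Continuous fun x : Space d => x i).measurable measurableSet_Ico

instance isFiniteMeasure_cellMeasure (d : ℕ) : IsFiniteMeasure (cellMeasure d) :=
  isFiniteMeasure_restrict.2
    ((measure_mono (cell_subset d)).trans_lt (isCompact_box d).measure_lt_top).ne

theorem memLp_of_continuous {d : ℕ} {F : Type*} [NormedAddCommGroup F] {f : Space d → F}
    (hf : Continuous f) : MemLp f 2 (cellMeasure d) := by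
  obtain ⟨C, hC⟩ := (isCompact_box d).exists_bound_of_continuousOn hf.continuousOn
  refine MemLp.of_bound hf.aestronglyMeasurable C ?_
  exact (ae_restrict_iff' (measurableSet_cell d)).2
    (Filter.Eventually.of_forall fun x hx => hC x (cell_subset d hx))

theorem continuous_fderiv_test {d : ℕ} {χ : Space d → ℝ}
    (hχ : ContDiff ℝ ((⊤ : ℕ∞) : WithTop ℕ∞) χ) (w : Space d) :
    Continuous fun x => fderiv ℝ χ x w :=
  (hχ.continuous_fderiv (by simp)).clm_apply continuous_const

theorem integrable_mul_test {d : ℕ} (u : L2 d) {f : Space d → ℝ} (hf : Continuous f) :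
    Integrable (fun x => u x * f x) (cellMeasure d) :=
  (Lp.memLp u).integrable_mul (memLp_of_continuous hf)

theorem integrable_inner_mul_test {d : ℕ} (g : L2Vec d) (w : Space d) {f : Space d → ℝ}
    (hf : Continuous f) :
    Integrable (fun x => ⟪g x, w⟫_ℝ * f x) (cellMeasure d) :=
  ((Lp.memLp g).inner_const w).integrable_mul (memLp_of_continuous hf)

/-- `H¹_per(Q)`: the pairs `(u, ∇u)` of an `L²` function and its periodic weak gradient, a
subspace of the Hilbert space `L²(Q) × L²(Q; ℝ^d)`, whose norm is `(‖u‖² + ‖∇u‖²)^{1/2}`. -/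
noncomputable def H1per (d : ℕ) : Submodule ℝ (WithLp 2 (L2 d × L2Vec d)) where
  carrier := {p | IsWeakGradient p.fst p.snd}
  zero_mem' := by
    intro χ hχ hp w
    have h1 : ∫ x, (0 : L2 d) x * fderiv ℝ χ x w ∂cellMeasure d = 0 := by
      refine integral_eq_zero_of_ae ?_
      filter_upwards [Lp.coeFn_zero ℝ 2 (cellMeasure d)] with x hx
      rw [hx, Pi.zero_apply, zero_mul]
    have h2 : ∫ x, ⟪(0 : L2Vec d) x, w⟫_ℝ * χ x ∂cellMeasure d = 0 := by
      refine integral_eq_zero_of_ae ?_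
      filter_upwards [Lp.coeFn_zero (Space d) 2 (cellMeasure d)] with x hx
      rw [hx, Pi.zero_apply, Pi.zero_apply, inner_zero_left, zero_mul]
    refine h1.trans ?_
    rw [← neg_zero]
    exact congrArg Neg.neg h2.symm
  add_mem' := by
    intro p q hp hq χ hχ hper w
    have h1 : ∫ x, (p.fst + q.fst : L2 d) x * fderiv ℝ χ x w ∂cellMeasure d
        = (∫ x, p.fst x * fderiv ℝ χ x w ∂cellMeasure d)
          + ∫ x, q.fst x * fderiv ℝ χ x w ∂cellMeasure d := by
      rw [← integral_add (integrable_mul_test _ (continuous_fderiv_test hχ w))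
        (integrable_mul_test _ (continuous_fderiv_test hχ w))]
      refine integral_congr_ae ?_
      filter_upwards [Lp.coeFn_add p.fst q.fst] with x hx
      rw [hx, Pi.add_apply, add_mul]
    have h2 : ∫ x, ⟪(p.snd + q.snd : L2Vec d) x, w⟫_ℝ * χ x ∂cellMeasure d
        = (∫ x, ⟪p.snd x, w⟫_ℝ * χ x ∂cellMeasure d)
          + ∫ x, ⟪q.snd x, w⟫_ℝ * χ x ∂cellMeasure d := by
      rw [← integral_add (integrable_inner_mul_test _ w hχ.continuous)
        (integrable_inner_mul_test _ w hχ.continuous)]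
      refine integral_congr_ae ?_
      filter_upwards [Lp.coeFn_add p.snd q.snd] with x hx
      rw [hx, Pi.add_apply, inner_add_left, add_mul]
    refine h1.trans ?_
    rw [hp χ hχ hper w, hq χ hχ hper w]
    exact (neg_add _ _).symm.trans (congrArg Neg.neg h2.symm)
  smul_mem' := by
    intro c p hp χ hχ hper w
    have h1 : ∫ x, (c • p.fst : L2 d) x * fderiv ℝ χ x w ∂cellMeasure d
        = c * ∫ x, p.fst x * fderiv ℝ χ x w ∂cellMeasure d := by
      rw [← integral_const_mul]
      refine integral_congr_ae ?_
      filter_upwards [Lp.coeFn_smul c p.fst] with x hx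
      simp [hx, mul_assoc]
    have h2 : ∫ x, ⟪(c • p.snd : L2Vec d) x, w⟫_ℝ * χ x ∂cellMeasure d
        = c * ∫ x, ⟪p.snd x, w⟫_ℝ * χ x ∂cellMeasure d := by
      rw [← integral_const_mul]
      refine integral_congr_ae ?_
      filter_upwards [Lp.coeFn_smul c p.snd] with x hx
      simp [hx, mul_assoc, real_inner_smul_left]
    refine h1.trans ?_
    rw [hp χ hχ hper w, mul_neg]
    exact congrArg Neg.neg h2.symm

/-- The underlying `L²` function of an element of `H¹_per(Q)`. -/
noncomputable def val {d : ℕ} (u : H1per d) : L2 d := (u : WithLp 2 (L2 d × L2Vec d)).fst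

/-- The weak gradient of an element of `H¹_per(Q)`. -/
noncomputable def grad {d : ℕ} (u : H1per d) : L2Vec d :=
  (u : WithLp 2 (L2 d × L2Vec d)).snd

/-- `H^{-1}_per(Q)`, the dual of `H¹_per(Q)`. -/
abbrev Hm1per (d : ℕ) : Type := H1per d →L[ℝ] ℝ

/-- `φ` is a `Q`-periodic weak solution of `-∇·A(ξ + ∇φ) = 0` with zero average. -/
def IsCorrector {d : ℕ} (A : Space d → Matrix (Fin d) (Fin d) ℝ) (ξ : Space d)
    (φ : H1per d) : Prop :=
  (∫ x, val φ x ∂cellMeasure d = 0) ∧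
    ∀ v : H1per d, ∫ x, ⟪grad v x, act (A x) (ξ + grad φ x)⟫_ℝ ∂cellMeasure d = 0

/-- `Ahom` is the homogenized matrix of `A`: the symmetric matrix with
`ξ · Ahom ξ = ⟨(ξ + ∇φ) · A (ξ + ∇φ)⟩`, where `φ` is the unique corrector in direction `ξ`. -/
def IsHomogenizedMatrix {d : ℕ} (A : Space d → Matrix (Fin d) (Fin d) ℝ)
    (Ahom : Matrix (Fin d) (Fin d) ℝ) : Prop :=
  Ahom.IsSymm ∧ ∀ ξ : Space d, (∃! φ : H1per d, IsCorrector A ξ φ) ∧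
    ∀ φ : H1per d, IsCorrector A ξ φ →
      ⟪ξ, act Ahom ξ⟫_ℝ
        = ∫ x, ⟪ξ + grad φ x, act (A x) (ξ + grad φ x)⟫_ℝ ∂cellMeasure d

/-- `u = 𝓛⁻¹ f`, where `𝓛 = -∇·A∇` with periodic boundary conditions on `L²_0(Q)`: `u` has zero
average, and `∫_Q ∇v · A∇u = ∫_Q f v` for all `v ∈ H¹_per(Q)`. -/
def IsInverseImage {d : ℕ} (A : Space d → Matrix (Fin d) (Fin d) ℝ) (f : L2 d)
    (u : H1per d) : Prop :=
  (∫ x, val u x ∂cellMeasure d = 0) ∧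
    ∀ v : H1per d, ∫ x, ⟪grad v x, act (A x) (grad u x)⟫_ℝ ∂cellMeasure d
      = ∫ x, f x * val v x ∂cellMeasure d

/-- An orthonormal basis `(ψ_i)` of `L²_0(Q)` and positive numbers `λ_i` with
`𝓛⁻¹ ψ_i = λ_i⁻¹ ψ_i`. The numbering starts at `0` and is arbitrary: the spectral measure below
does not depend on it. -/
structure EigenBasis {d : ℕ} (A : Space d → Matrix (Fin d) (Fin d) ℝ) where
  /-- the eigenfunctions -/
  psi : ℕ → H1per d
  /-- the eigenvalues -/
  eigenvalue : ℕ → ℝ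
  eigenvalue_pos : ∀ i, 0 < eigenvalue i
  orthonormal : Orthonormal ℝ (fun i => val (psi i))
  complete : ∀ f : L2 d,
    f ∈ (Submodule.span ℝ (Set.range fun i => val (psi i))).topologicalClosure ↔
      ∫ x, f x ∂cellMeasure d = 0
  eigen : ∀ i, IsInverseImage A (val (psi i)) ((eigenvalue i)⁻¹ • psi i)

/-- The spectral measure `e_f = ∑_i ⟨f, ψ_i⟩² δ_{λ_i}` of `𝓛` projected on an element `f` of
`H^{-1}_per(Q)` with `⟨f, 1⟩ = 0` (so that there is no contribution of the constant mode). -/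
noncomputable def EigenBasis.spectralMeasure {d : ℕ}
    {A : Space d → Matrix (Fin d) (Fin d) ℝ} (S : EigenBasis A) (f : Hm1per d) : Measure ℝ :=
  Measure.sum fun i => ENNReal.ofReal (f (S.psi i) ^ 2) • Measure.dirac (S.eigenvalue i)

theorem memLp_act {d : ℕ} {A : Space d → Matrix (Fin d) (Fin d) ℝ} {α β : ℝ}
    (hA : IsPeriodicDiffusion A α β) (ξ : Space d) :
    MemLp (fun x => act (A x) ξ) 2 (cellMeasure d) := by
  have hc : Continuous fun x => WithLp.toLp 2 ((A x).mulVec (WithLp.ofLp ξ)) :=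
    (PiLp.continuous_toLp 2 _).comp
      (hA.uniformContinuous.continuous.matrix_mulVec continuous_const)
  exact memLp_of_continuous hc

/-- The local drift `𝔡 = ∇·Aξ ∈ H^{-1}_per(Q)`, that is `⟨𝔡, v⟩ = -∫_Q Aξ · ∇v`. -/
noncomputable def localDrift {d : ℕ} {A : Space d → Matrix (Fin d) (Fin d) ℝ} {α β : ℝ}
    (hA : IsPeriodicDiffusion A α β) (ξ : Space d) : Hm1per d :=
  -((innerSL ℝ ((memLp_act hA ξ).toLp _)).comp
      ((WithLp.sndL 2 ℝ (L2 d) (L2Vec d)).comp (H1per d).subtypeL))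

theorem localDrift_apply {d : ℕ} {A : Space d → Matrix (Fin d) (Fin d) ℝ} {α β : ℝ}
    (hA : IsPeriodicDiffusion A α β) (ξ : Space d) (v : H1per d) :
    localDrift hA ξ v = - ∫ x, ⟪act (A x) ξ, grad v x⟫_ℝ ∂cellMeasure d := by
  have h : localDrift hA ξ v = -⟪(memLp_act hA ξ).toLp _, grad v⟫_ℝ := rfl
  rw [h, L2.inner_def]
  congr 1
  refine integral_congr_ae ?_
  filter_upwards [(memLp_act hA ξ).coeFn_toLp] with x hx
  rw [hx]

/-- The product `(μ + λ)² (2μ + λ)² ⋯ (2^{k-1}μ + λ)²` as a polynomial in `λ`. -/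
noncomputable def prodPoly (k : ℕ) (μ : ℝ) : Polynomial ℝ :=
  ∏ j ∈ Finset.range k, (Polynomial.C (2 ^ j * μ) + Polynomial.X) ^ 2

/-- The polynomial `P_k(μ, ·)`, the quotient by `λ` of
`(μ + λ)² (2μ + λ)² ⋯ (2^{k-1}μ + λ)² - 2^{k(k-1)} μ^{2k}`; the division is exact
(see `P_eval`). -/
noncomputable def P (k : ℕ) (μ : ℝ) : Polynomial ℝ :=
  (prodPoly k μ - Polynomial.C (2 ^ (k * (k - 1)) * μ ^ (2 * k))).divX

theorem prodPoly_eval (k : ℕ) (μ l : ℝ) :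
    (prodPoly k μ).eval l = ∏ j ∈ Finset.range k, (2 ^ j * μ + l) ^ 2 := by
  simp [prodPoly, Polynomial.eval_prod]

theorem prod_eval_zero (k : ℕ) (μ : ℝ) :
    ∏ j ∈ Finset.range k, (2 ^ j * μ + 0) ^ 2 = 2 ^ (k * (k - 1)) * μ ^ (2 * k) := by
  rw [← Finset.sum_range_id_mul_two, pow_mul (2 : ℝ), ← Finset.prod_pow_eq_pow_sum,
    ← Finset.prod_pow, mul_comm 2 k, pow_mul' μ, ← Finset.card_range k, ← Finset.prod_const,
    Finset.card_range, ← Finset.prod_mul_distrib]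
  exact Finset.prod_congr rfl fun j _ => by ring

theorem P_eval {k : ℕ} {μ l : ℝ} (hl : l ≠ 0) :
    (P k μ).eval l = l⁻¹ * ((∏ j ∈ Finset.range k, (2 ^ j * μ + l) ^ 2)
      - 2 ^ (k * (k - 1)) * μ ^ (2 * k)) := by
  have h := congrArg (Polynomial.eval l) (Polynomial.X_mul_divX_add
    (prodPoly k μ - Polynomial.C (2 ^ (k * (k - 1)) * μ ^ (2 * k))))
  rw [Polynomial.coeff_zero_eq_eval_zero, Polynomial.eval_sub, prodPoly_eval,
    prod_eval_zero] at h
  simp only [Polynomial.eval_add, Polynomial.eval_mul, Polynomial.eval_X, Polynomial.eval_C,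
    Polynomial.eval_sub, prodPoly_eval, sub_self, add_zero] at h
  rw [eq_inv_mul_iff_mul_eq₀ hl]
  exact h

/-- `M` is the approximation `A_{μ,k}` of the homogenized matrix: the symmetric matrix with
`ξ · M ξ = ⟨ξ · Aξ⟩ - ∫ P_k(μ,λ) / ((μ+λ)² ⋯ (2^{k-1}μ+λ)²) de_𝔡(λ)`, with `𝔡 = ∇·Aξ`. -/
def IsApproxMatrix {d : ℕ} {A : Space d → Matrix (Fin d) (Fin d) ℝ} {α β : ℝ}
    (hA : IsPeriodicDiffusion A α β) (S : EigenBasis A) (k : ℕ) (μ : ℝ)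
    (M : Matrix (Fin d) (Fin d) ℝ) : Prop :=
  M.IsSymm ∧ ∀ ξ : Space d,
    Integrable (fun l => (P k μ).eval l / (prodPoly k μ).eval l)
      (S.spectralMeasure (localDrift hA ξ)) ∧
    ⟪ξ, act M ξ⟫_ℝ = (∫ x, ⟪ξ, act (A x) ξ⟫_ℝ ∂cellMeasure d)
      - ∫ l, (P k μ).eval l / (prodPoly k μ).eval l ∂S.spectralMeasure (localDrift hA ξ)

end PeriodicHom

open PeriodicHom

/-! ### Coercive forms, spectral decomposition and compactness in Hilbert spaces -/

section FunctionalAnalysis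

/-! Let B be the Dirichlet form on `H0`, the zero-average functions. It is coercive by Poincaré, so
Lax–Milgram gives the corrector φ with B(φ, v) = ⟨𝔡, v⟩. Expanding the energy gives ξ·A_hom ξ =
⟨ξ·Aξ⟩ - ⟨𝔡, φ⟩ (`integral_corrector_energy`). The embedding of `H0` in L² is compact, which yields
the eigenbasis. The expansion of φ converges in `H0` with coefficients λ_i⁻¹⟨𝔡, ψ_i⟩, hence ⟨𝔡, φ⟩ =
∑ λ_i⁻¹⟨𝔡, ψ_i⟩² (`hasSum_localDrift`).

The multiplier of A_{μ,k} equals λ⁻¹(1 - r(λ)), where r(λ) = 2^{k(k-1)} μ^{2k} / ∏ (2^j μ + λ)². The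
error is therefore exactly ∑ r(λ_i) λ_i⁻¹⟨𝔡, ψ_i⟩² (`hasSum_error`), which is nonnegative. Three
bounds conclude: r(λ) ≤ 2^{k(k-1)} (μ/λ)^{2k}, by dropping 2^j μ in each factor; λ_i ≥ 4απ², by the
sharp Poincaré inequality; and ⟨𝔡, φ⟩ ≤ α⁻¹⟨|A|²⟩, by Cauchy–Schwarz.

The Sobolev facts (Poincaré, compactness, uniqueness of the weak gradient) all come from Parseval on
the torus. Both matrices are obtained from symmetric bilinear forms in (ξ, η), and polarization
makes them unique. -/

theorem Orthonormal.countable_index {ι H : Type*} [NormedAddCommGroup H] [InnerProductSpace ℝ H]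
    [SecondCountableTopology H] {v : ι → H}
    (hv : Orthonormal ℝ v) : Countable ι := by
  refine Pairwise.countable_of_isOpen_disjoint (s := fun i => Metric.ball (v i) (1 / 2))
    (fun i j hij => ?_) (fun i => Metric.isOpen_ball)
    (fun i => ⟨v i, Metric.mem_ball_self (by norm_num)⟩)
  -- Distinct orthonormal vectors are at distance √2, more than the sum of the two radii.
  refine Metric.ball_disjoint_ball ?_
  have h : ‖v i - v j‖ ^ 2 = 2 := by
    rw [norm_sub_sq_real, hv.1 i, hv.1 j, hv.2 hij]
    norm_num
  rw [dist_eq_norm]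
  nlinarith [norm_nonneg (v i - v j)]

theorem IsCoercive.eq_of_forall_eq {V : Type*} [NormedAddCommGroup V] [InnerProductSpace ℝ V]
    {B : V →L[ℝ] V →L[ℝ] ℝ} (hB : IsCoercive B) {u w : V}
    (h : ∀ v, B u v = B w v) : u = w := by
  obtain ⟨C, hC, hc⟩ := hB
  have h1 := hc (u - w)
  rw [map_sub B, sub_apply, h, sub_self] at h1
  have h2 : ‖u - w‖ * ‖u - w‖ ≤ 0 := by
    by_contra! h3
    nlinarith [mul_pos hC h3]
  have h3 : ‖u - w‖ = 0 := by nlinarith [norm_nonneg (u - w)]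
  exact sub_eq_zero.1 (norm_eq_zero.1 h3)

variable {V H : Type*} [NormedAddCommGroup V] [InnerProductSpace ℝ V] [CompleteSpace V]
  [NormedAddCommGroup H] [InnerProductSpace ℝ H] [CompleteSpace H]

/-- Lax–Milgram, after the Riesz map turns ℓ into a vector. -/
theorem IsCoercive.exists_solution {B : V →L[ℝ] V →L[ℝ] ℝ} (hB : IsCoercive B)
    (ℓ : V →L[ℝ] ℝ) : ∃ u, ∀ v, B u v = ℓ v := by
  refine ⟨hB.continuousLinearEquivOfBilin.symm ((InnerProductSpace.toDual ℝ V).symm ℓ),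
    fun v => ?_⟩
  rw [← hB.continuousLinearEquivOfBilin_apply]
  simp

/-- A compact symmetric operator has an orthonormal family of eigenvectors for nonzero eigenvalues
whose orthogonal complement is the kernel. -/
theorem exists_orthonormal_eigenvectors {T : H →L[ℝ] H} (hT : IsCompactOperator T)
    (hs : (T : H →ₗ[ℝ] H).IsSymmetric) :
    ∃ (ι : Type) (e : ι → H) (m : ι → ℝ), Orthonormal ℝ e ∧ (∀ i, m i ≠ 0) ∧
      (∀ i, T (e i) = m i • e i) ∧
      ∀ x, (∀ i, ⟪e i, x⟫_ℝ = 0) → T x = 0 := by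
  classical
  let N : Type := {μ : ℝ // μ ≠ 0}
  let E : ℝ → Submodule ℝ H := fun μ => Module.End.eigenspace (T : Module.End ℝ H) μ
  have hfin : ∀ μ : N, FiniteDimensional ℝ (E μ) := fun μ =>
    ContinuousLinearMap.finite_dimensional_eigenspace hT μ.1 μ.2
  let b : ∀ μ : N, OrthonormalBasis (Fin (Module.finrank ℝ (E μ))) ℝ (E μ) :=
    fun μ => stdOrthonormalBasis ℝ (E μ)
  have hfam : OrthogonalFamily ℝ (fun μ : N => E μ) fun μ => (E μ).subtypeₗᵢ :=
    hs.orthogonalFamily_eigenspaces.comp Subtype.val_injective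
  refine ⟨Σ μ : N, Fin (Module.finrank ℝ (E μ)), fun a => (b a.1 a.2 : H), fun a => a.1.1,
    hfam.orthonormal_sigma_orthonormal fun μ => (b μ).orthonormal, fun a => a.1.2,
    fun a => Module.End.mem_eigenspace_iff.1 (b a.1 a.2).2, fun x hx => ?_⟩
  have hx' : ∀ μ : N, ∀ y ∈ E μ, ⟪y, x⟫_ℝ = 0 := by
    intro μ y hy
    have h := (b μ).sum_repr ⟨y, hy⟩
    have h2 := congrArg (Subtype.val) h
    rw [Submodule.coe_sum] at h2
    change _ = y at h2
    rw [← h2, sum_inner]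
    refine Finset.sum_eq_zero fun i _ => ?_
    rw [Submodule.coe_smul, real_inner_smul_left, hx ⟨μ, i⟩, mul_zero]
  have hcl : IsClosed (E 0 : Set H) := by
    have : (E 0 : Set H) = T ⁻¹' {0} := by
      ext y
      change y ∈ Module.End.eigenspace _ _ ↔ _
      rw [Module.End.mem_eigenspace_iff]
      simp
    rw [this]
    exact isClosed_singleton.preimage T.continuous
  have : CompleteSpace (E 0) := hcl.completeSpace_coe
  -- Split off the kernel part x0. What is left is orthogonal to every eigenspace, so it vanishes by
  -- the spectral theorem for compact symmetric operators.
  obtain ⟨x0, h0, x1, h1, hx01⟩ := (E 0).exists_add_mem_mem_orthogonal x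
  have hall : ∀ μ, ∀ y ∈ E μ, ⟪y, x1⟫_ℝ = 0 := by
    intro μ y hy
    by_cases hμ : μ = 0
    · subst hμ
      exact h1 y hy
    · have : ⟪y, x0⟫_ℝ = 0 :=
        hs.orthogonalFamily_eigenspaces hμ ⟨y, hy⟩ ⟨x0, h0⟩
      have hyx := hx' ⟨μ, hμ⟩ y hy
      rw [hx01, inner_add_right, this, zero_add] at hyx
      exact hyx
  have hx1 : x1 ∈ (⨆ μ, E μ)ᗮ := by
    rw [← Submodule.iInf_orthogonal]
    exact (Submodule.mem_iInf _).2 hall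
  rw [ContinuousLinearMap.orthogonalComplement_iSup_eigenspaces_eq_bot hT hs,
    Submodule.mem_bot] at hx1
  rw [hx01, hx1, add_zero]
  simpa using Module.End.mem_eigenspace_iff.1 h0

theorem Submodule.mem_closure_of_forall_inner_eq_zero {K : Submodule ℝ H} {x : H}
    (h : ∀ y, (∀ z ∈ K, ⟪z, y⟫_ℝ = 0) → ⟪x, y⟫_ℝ = 0) : x ∈ K.topologicalClosure := by
  rw [← Submodule.orthogonal_orthogonal_eq_closure]
  intro y hy
  rw [real_inner_comm]
  exact h y hy

/-- Spectral decomposition of a coercive symmetric form on a compactly embedded Hilbert space. -/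
theorem exists_eigenbasis [SecondCountableTopology H] {B : V →L[ℝ] V →L[ℝ] ℝ}
    (hB : IsCoercive B) (hs : ∀ u v, B u v = B v u) (J : V →L[ℝ] H) (hJ : Function.Injective J)
    (hc : IsCompactOperator J) (hinf : ¬ FiniteDimensional ℝ V) :
    ∃ (ψ : ℕ → V) (l : ℕ → ℝ), (∀ i, 0 < l i) ∧ Orthonormal ℝ (fun i => J (ψ i)) ∧
      (Submodule.span ℝ (Set.range fun i => J (ψ i))).topologicalClosure
        = (LinearMap.range (J : V →ₗ[ℝ] H)).topologicalClosure ∧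
      ∀ i v, B (ψ i) v = l i * ⟪J (ψ i), J v⟫_ℝ := by
  -- S is the solution operator, B(S f, v) = ⟪f, J v⟫. The operator J ∘ S is compact and symmetric
  -- on H, and its eigenvalues are the inverses of those sought.
  let S : H →L[ℝ] V := (hB.continuousLinearEquivOfBilin.symm : V →L[ℝ] V).comp
    (ContinuousLinearMap.adjoint J)
  have hS : ∀ f v, B (S f) v = ⟪f, J v⟫_ℝ := by
    intro f v
    rw [← hB.continuousLinearEquivOfBilin_apply, ← ContinuousLinearMap.adjoint_inner_left]
    simp [S]
  let T : H →L[ℝ] H := J.comp S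
  have hTc : IsCompactOperator T := hc.comp_clm S
  have hTs : (T : H →ₗ[ℝ] H).IsSymmetric := by
    intro f g
    change ⟪J (S f), g⟫_ℝ = ⟪f, J (S g)⟫_ℝ
    rw [← hS, hs, real_inner_comm, hS]
  obtain ⟨ι, e, m, he, hm, hTe, hker⟩ := exists_orthonormal_eigenvectors hTc hTs
  -- The factor (m i)⁻¹ normalizes the lift of e i to V, so that J maps it to e i itself.
  let p : ι → V := fun i => (m i)⁻¹ • S (e i)
  have hJp : ∀ i, J (p i) = e i := by
    intro i
    change J ((m i)⁻¹ • S (e i)) = e i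
    rw [map_smul]
    change (m i)⁻¹ • T (e i) = e i
    rw [hTe, smul_smul, inv_mul_cancel₀ (hm i), one_smul]
  have hBp : ∀ i v, B (p i) v = (m i)⁻¹ * ⟪e i, J v⟫_ℝ := by
    intro i v
    simp only [p, map_smul, smul_apply, hS, smul_eq_mul]
  have hpos : ∀ i, 0 < (m i)⁻¹ := by
    intro i
    have h1 := hBp i (p i)
    rw [hJp, real_inner_self_eq_norm_sq, he.1 i, one_pow, mul_one] at h1
    rw [← h1]
    obtain ⟨C, hC, hco⟩ := hB
    refine lt_of_lt_of_le ?_ (hco (p i))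
    have : p i ≠ 0 := by
      intro h0
      have h2 := hJp i
      rw [h0, map_zero] at h2
      exact he.ne_zero i h2.symm
    have := norm_pos_iff.2 this
    positivity
  have hcl : (Submodule.span ℝ (Set.range e)).topologicalClosure
      = (LinearMap.range (J : V →ₗ[ℝ] H)).topologicalClosure := by
    apply le_antisymm
    · refine Submodule.topologicalClosure_mono (Submodule.span_le.2 ?_)
      rintro _ ⟨i, rfl⟩
      exact ⟨p i, hJp i⟩
    · refine Submodule.topologicalClosure_minimal _ ?_ (Submodule.isClosed_topologicalClosure _)
      rintro _ ⟨v, rfl⟩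
      refine Submodule.mem_closure_of_forall_inner_eq_zero fun y hy => ?_
      -- If y is orthogonal to every e i, then J (S y) = 0, so S y = 0 by injectivity, and ⟪y, J v⟫
      -- = B(S y, v) = 0.
      have hTy : J (S y) = 0 := hker y fun i => hy _ (Submodule.subset_span ⟨i, rfl⟩)
      have hSy : S y = 0 := hJ (by rw [hTy, map_zero])
      have := hS y v
      rw [hSy, map_zero, zero_apply] at this
      rw [real_inner_comm]
      exact this.symm
  have hcount : Countable ι := he.countable_index
  -- A finite family would confine the range of J to a finite-dimensional space. Infinitude allows
  -- the reindexing by ℕ.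
  have hinfι : Infinite ι := by
    by_contra hfin
    rw [not_infinite_iff_finite] at hfin
    have hfd : FiniteDimensional ℝ (Submodule.span ℝ (Set.range e)) :=
      FiniteDimensional.span_of_finite ℝ (Set.finite_range e)
    have hle : LinearMap.range (J : V →ₗ[ℝ] H) ≤ Submodule.span ℝ (Set.range e) := by
      rw [← (Submodule.closed_of_finiteDimensional
        (Submodule.span ℝ (Set.range e))).submodule_topologicalClosure_eq, hcl]
      exact Submodule.le_topologicalClosure _
    have : FiniteDimensional ℝ (LinearMap.range (J : V →ₗ[ℝ] H)) :=
      Submodule.finiteDimensional_of_le hle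
    exact hinf (LinearEquiv.ofInjective (J : V →ₗ[ℝ] H) hJ).symm.finiteDimensional
  obtain ⟨eqv⟩ : Nonempty (ℕ ≃ ι) := by
    obtain ⟨d⟩ := nonempty_denumerable ι
    exact ⟨(Denumerable.eqv ι).symm⟩
  refine ⟨fun n => p (eqv n), fun n => (m (eqv n))⁻¹, fun n => hpos _, ?_, ?_, ?_⟩
  · simp only [hJp]
    exact he.comp eqv eqv.injective
  · simp only [hJp]
    rw [← hcl]
    congr 2
    exact eqv.surjective.range_comp e
  · intro n v
    rw [hBp, hJp]

/-- The convergence is in V, not merely in H, so that functionals continuous only on V can be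
applied term by term. The ψ i are B-orthogonal, so Bessel's inequality in energy makes ∑ l i * c i ^
2 converge, and coercivity turns this into summability in V. The sum is φ because both have the same
J-coefficients. -/
theorem hasSum_eigenbasis {B : V →L[ℝ] V →L[ℝ] ℝ} (hB : IsCoercive B)
    (hs : ∀ u v, B u v = B v u) (J : V →L[ℝ] H) (hJ : Function.Injective J)
    {ψ : ℕ → V} {l : ℕ → ℝ} (hl : ∀ i, 0 < l i) (ho : Orthonormal ℝ (fun i => J (ψ i)))
    (hcl : ∀ v, J v ∈ (Submodule.span ℝ (Set.range fun i => J (ψ i))).topologicalClosure)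
    (hψ : ∀ i v, B (ψ i) v = l i * ⟪J (ψ i), J v⟫_ℝ) (φ : V) :
    HasSum (fun i => ((l i)⁻¹ * B φ (ψ i)) • ψ i) φ := by
  set c : ℕ → ℝ := fun i => (l i)⁻¹ * B φ (ψ i) with hcdef
  have hBc : ∀ i, B φ (ψ i) = l i * c i := fun i => by
    rw [hcdef, mul_inv_cancel_left₀ (hl i).ne']
  have hJc : ∀ i, ⟪J (ψ i), J φ⟫_ℝ = c i := fun i => by
    rw [hcdef]
    dsimp only
    rw [hs, hψ, inv_mul_cancel_left₀ (hl i).ne']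
  have hBsum : ∀ t : Finset ℕ, B (∑ i ∈ t, c i • ψ i) (∑ i ∈ t, c i • ψ i)
      = ∑ i ∈ t, l i * c i ^ 2 := by
    intro t
    simp only [map_sum, map_smul, sum_apply, smul_apply,
      hψ, smul_eq_mul]
    refine Finset.sum_congr rfl fun i hi => ?_
    rw [Finset.sum_eq_single i]
    · rw [(orthonormal_iff_ite.1 ho i i), if_pos rfl]
      ring
    · intro j _ hj
      rw [orthonormal_iff_ite.1 ho, if_neg hj]
      ring
    · exact fun h => (h hi).elim
  have hnonneg : ∀ v, 0 ≤ B v v := fun v => by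
    obtain ⟨C, hC, hc⟩ := hB
    exact le_trans (by positivity) (hc v)
  have hsummable : Summable fun i => l i * c i ^ 2 := by
    refine summable_of_sum_le (c := B φ φ) (fun i => mul_nonneg (hl i).le (sq_nonneg _)) fun t => ?_
    -- Bessel's inequality: the energy of the remainder is B φ φ minus the partial sum.
    have h1 := hnonneg (φ - ∑ i ∈ t, c i • ψ i)
    have h2 : B φ (∑ i ∈ t, c i • ψ i) = ∑ i ∈ t, l i * c i ^ 2 := by
      simp only [map_sum, map_smul, smul_eq_mul, hBc]
      exact Finset.sum_congr rfl fun i _ => by ring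
    rw [map_sub B, sub_apply, map_sub, map_sub, hBsum,
      hs (∑ i ∈ t, c i • ψ i) φ, h2] at h1
    linarith
  have hsum : Summable fun i => c i • ψ i := by
    obtain ⟨C, hC, hc⟩ := hB
    rw [summable_iff_vanishing_norm]
    intro ε hε
    obtain ⟨s, hs'⟩ := summable_iff_vanishing_norm.1 hsummable (C * ε ^ 2) (by positivity)
    refine ⟨s, fun t ht => ?_⟩
    have h1 := hs' t ht
    rw [Real.norm_of_nonneg (Finset.sum_nonneg fun i _ => mul_nonneg (hl i).le (sq_nonneg _)),
      ← hBsum] at h1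
    have h2 := (hc _).trans_lt h1
    rw [mul_assoc, mul_lt_mul_iff_right₀ hC, ← sq] at h2
    exact lt_of_pow_lt_pow_left₀ 2 hε.le h2
  obtain ⟨φ', hφ'⟩ := hsum
  have hin : ∀ i, ⟪J (ψ i), J (φ' - φ)⟫_ℝ = 0 := by
    intro i
    have h1 : HasSum (fun j => ⟪J (ψ i), J (c j • ψ j)⟫_ℝ) ⟪J (ψ i), J φ'⟫_ℝ :=
      ((innerSL ℝ (J (ψ i))).comp J).hasSum hφ'
    have h2 : HasSum (fun j => ⟪J (ψ i), J (c j • ψ j)⟫_ℝ) (c i) := by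
      have := hasSum_single (f := fun j => ⟪J (ψ i), J (c j • ψ j)⟫_ℝ) i fun j hj => by
        rw [map_smul, real_inner_smul_right, orthonormal_iff_ite.1 ho, if_neg hj.symm, mul_zero]
      rwa [map_smul, real_inner_smul_right, orthonormal_iff_ite.1 ho, if_pos rfl, mul_one] at this
    rw [map_sub, inner_sub_right, h1.unique h2, hJc, sub_self]
  have hzero : J (φ' - φ) = 0 := by
    have h1 : J (φ' - φ) ∈ (Submodule.span ℝ (Set.range fun i => J (ψ i)))ᗮ := by
      refine (Submodule.mem_orthogonal _ _).2 fun u hu => ?_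
      induction hu using Submodule.span_induction with
      | mem x hx =>
        obtain ⟨i, rfl⟩ := hx
        exact hin i
      | zero => exact inner_zero_left _
      | add x y _ _ hx hy => rw [inner_add_left, hx, hy, add_zero]
      | smul a x _ hx => rw [real_inner_smul_left, hx, mul_zero]
    have h2 := hcl (φ' - φ)
    rw [← Submodule.orthogonal_orthogonal_eq_closure] at h2
    exact inner_self_eq_zero.1 (h2 _ h1)
  have : φ' = φ := sub_eq_zero.1 (hJ (by rw [hzero, map_zero]))
  rwa [this] at hφ'

/-- J is a norm limit of finite-rank operators. Projecting onto the span of the J* f, f ∈ s, leaves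
a remainder v with ⟪f, J v⟫ = ⟪J* f, v⟫ = 0, to which the hypothesis applies. -/
theorem isCompactOperator_of_forall_exists_finite (J : V →L[ℝ] H)
    (h : ∀ ε : ℝ, 0 < ε → ∃ s : Finset H, ∀ u : V, (∀ f ∈ s, ⟪f, J u⟫_ℝ = 0) →
      ‖J u‖ ≤ ε * ‖u‖) : IsCompactOperator J := by
  refine (isClosed_setOfPred_isCompactOperator (σ₁₂ := RingHom.id ℝ) (M₁ := V)
    (M₂ := H)).closure_subset ?_
  rw [Metric.mem_closure_iff]
  intro ε hε
  obtain ⟨s, hs⟩ := h (ε / 2) (by positivity)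
  let K : Submodule ℝ V := Submodule.span ℝ ((fun f => ContinuousLinearMap.adjoint J f) '' s)
  have hfd : FiniteDimensional ℝ K :=
    FiniteDimensional.span_of_finite ℝ (s.finite_toSet.image _)
  refine ⟨J.comp K.starProjection, ?_, ?_⟩
  · have h1 : IsCompactOperator (J.comp K.subtypeL) :=
      isCompactOperator_of_locallyCompactSpace_rng (J.comp K.subtypeL)
    exact h1.comp_clm K.orthogonalProjectionOnto
  · rw [dist_eq_norm]
    refine lt_of_le_of_lt (ContinuousLinearMap.opNorm_le_bound _ (half_pos hε).le fun u => ?_)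
      (half_lt_self hε)
    have h2 : (J - J.comp K.starProjection) u = J (u - K.starProjection u) := by
      simp
    rw [h2]
    have hmem : u - K.starProjection u ∈ Kᗮ := Submodule.sub_starProjection_mem_orthogonal u
    refine (hs _ fun f hf => ?_).trans ?_
    · rw [← ContinuousLinearMap.adjoint_inner_left]
      exact hmem _ (Submodule.subset_span ⟨f, hf, rfl⟩)
    · gcongr
      have h3 := K.norm_sq_eq_add_norm_sq_starProjection u
      rw [Submodule.starProjection_orthogonal_val] at h3
      nlinarith [norm_nonneg u, norm_nonneg (u - K.starProjection u),
        norm_nonneg (K.starProjection u)]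

end FunctionalAnalysis

/-! ### Symmetric matrices and their quadratic forms -/

section SymmetricMatrix

variable {d : ℕ}

theorem inner_act_eq_sum (M : Matrix (Fin d) (Fin d) ℝ) (ξ η : Space d) :
    ⟪ξ, act M η⟫_ℝ = ∑ i, ∑ j, ξ i * η j * M i j := by
  have h : act M η = WithLp.toLp 2 (M.mulVec (WithLp.ofLp η)) := rfl
  rw [h, PiLp.inner_apply]
  refine Finset.sum_congr rfl fun i _ => ?_
  simp only [Matrix.mulVec, dotProduct, RCLike.inner_apply, conj_trivial]
  rw [Finset.sum_mul]
  exact Finset.sum_congr rfl fun j _ => by ring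

theorem inner_act_single (M : Matrix (Fin d) (Fin d) ℝ) (i j : Fin d) :
    ⟪EuclideanSpace.single i (1 : ℝ), act M (EuclideanSpace.single j (1 : ℝ))⟫_ℝ = M i j := by
  classical
  rw [inner_act_eq_sum, Finset.sum_eq_single i, Finset.sum_eq_single j] <;>
    simp +contextual

theorem inner_act_comm {M : Matrix (Fin d) (Fin d) ℝ} (hM : M.IsSymm) (ξ η : Space d) :
    ⟪ξ, act M η⟫_ℝ = ⟪η, act M ξ⟫_ℝ := by
  rw [inner_act_eq_sum, inner_act_eq_sum, Finset.sum_comm]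
  refine Finset.sum_congr rfl fun i _ => Finset.sum_congr rfl fun j _ => ?_
  rw [hM.apply]
  ring

theorem act_sub (M N : Matrix (Fin d) (Fin d) ℝ) : act (M - N) = act M - act N :=
  map_sub _ _ _

/-- Polarization: the values at a, b and a + b determine the entry for (a, b). -/
theorem symm_ext {M N : Matrix (Fin d) (Fin d) ℝ} (hM : M.IsSymm) (hN : N.IsSymm)
    (h : ∀ ξ : Space d, ⟪ξ, act M ξ⟫_ℝ = ⟪ξ, act N ξ⟫_ℝ) : M = N := by
  ext i j
  rw [← inner_act_single M, ← inner_act_single N]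
  generalize EuclideanSpace.single i (1 : ℝ) = a
  generalize EuclideanSpace.single j (1 : ℝ) = b
  have h1 := h (a + b)
  simp only [map_add, inner_add_left, inner_add_right, h a, h b] at h1
  rw [inner_act_comm hM b a, inner_act_comm hN b a] at h1
  linarith

/-- Produces both the homogenized matrix and its approximations: it suffices to exhibit a symmetric
bilinear form whose diagonal is the prescribed quadratic expression. -/
theorem exists_symm_matrix (b : Space d → Space d → ℝ) (hs : ∀ ξ η, b ξ η = b η ξ)
    (hadd : ∀ ξ ξ' η, b (ξ + ξ') η = b ξ η + b ξ' η)
    (hsmul : ∀ (c : ℝ) ξ η, b (c • ξ) η = c * b ξ η) :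
    ∃ M : Matrix (Fin d) (Fin d) ℝ, M.IsSymm ∧ ∀ ξ, ⟪ξ, act M ξ⟫_ℝ = b ξ ξ := by
  classical
  let e : Fin d → Space d := fun i => EuclideanSpace.single i 1
  let B : Space d →ₗ[ℝ] Space d →ₗ[ℝ] ℝ := LinearMap.mk₂ ℝ b hadd hsmul
    (fun m n n' => by rw [hs, hadd, hs n, hs n']) (fun c m n => by rw [hs, hsmul, hs n]; rfl)
  refine ⟨Matrix.of fun i j => b (e i) (e j), ?_, fun ξ => ?_⟩
  · ext i j
    exact hs _ _
  · have hξ : ξ = ∑ i, ξ i • e i := by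
      ext k
      simp [e, Finset.sum_apply, Pi.single_apply]
    rw [inner_act_eq_sum]
    have h1 : b ξ ξ = B (∑ i, ξ i • e i) (∑ i, ξ i • e i) := by rw [← hξ]; rfl
    rw [h1]
    simp only [map_sum, map_smul, LinearMap.sum_apply, LinearMap.smul_apply, smul_eq_mul,
      Finset.mul_sum]
    refine Finset.sum_congr rfl fun i _ => Finset.sum_congr rfl fun j _ => ?_
    change _ = ξ i * (ξ j * b (e j) (e i))
    rw [hs (e j), Matrix.of_apply]
    ring

end SymmetricMatrix

/-! ### The periodic cell, the torus and Fourier modes -/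

section Cell

open scoped Pointwise

variable {d : ℕ}

/-- The vector of `ℝ^d` with the given integer coordinates. -/
noncomputable def latticeVec (n : Fin d → ℤ) : Space d := WithLp.toLp 2 fun i => (n i : ℝ)

theorem cell_eq_fundamentalDomain (d : ℕ) :
    cell d = ZSpan.fundamentalDomain (EuclideanSpace.basisFun (Fin d) ℝ).toBasis := by
  ext x
  simp [cell, ZSpan.mem_fundamentalDomain]

/-- The cell and its translate are both fundamental domains of ℤ^d, and a periodic function has the
same integral over each. -/
theorem setIntegral_cell_add {f : Space d → ℝ} (hf : IsPeriodic f) (w : Space d) :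
    ∫ x, f (x + w) ∂cellMeasure d = ∫ x, f x ∂cellMeasure d := by
  let b := (EuclideanSpace.basisFun (Fin d) ℝ).toBasis
  have hfd : IsAddFundamentalDomain (Submodule.span ℤ (Set.range b)).toAddSubgroup (cell d)
      (volume : Measure (Space d)) := by
    rw [cell_eq_fundamentalDomain]
    exact ZSpan.isAddFundamentalDomain' b _
  have hfd2 : IsAddFundamentalDomain (Submodule.span ℤ (Set.range b)).toAddSubgroup (w +ᵥ cell d)
      (volume : Measure (Space d)) := hfd.vadd_of_comm w
  have hinv : ∀ (g : (Submodule.span ℤ (Set.range b)).toAddSubgroup) (x : Space d), f (g +ᵥ x) = f x := by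
    intro g x
    have hg := (b.mem_span_iff_repr_mem ℤ (g : Space d)).1 g.2
    choose n hn using hg
    have h1 : (g : Space d) = WithLp.toLp 2 fun i => (n i : ℝ) := by
      ext i
      have := hn i
      simpa [b] using this.symm
    rw [AddSubgroup.vadd_def, vadd_eq_add, h1, add_comm]
    exact hf n x
  have : Countable (Submodule.span ℤ (Set.range b)).toAddSubgroup :=
    inferInstanceAs (Countable (Submodule.span ℤ (Set.range b)))
  have h2 := hfd2.setIntegral_eq hfd hinv
  rw [cellMeasure, ← h2]
  have hmp : MeasurePreserving (fun x : Space d => x + w) := measurePreserving_add_right _ w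
  have hemb : MeasurableEmbedding (fun x : Space d => x + w) := measurableEmbedding_addRight w
  rw [← hmp.setIntegral_preimage_emb hemb f]
  congr 2
  ext x
  rw [Set.mem_preimage, Set.mem_vadd_set_iff_neg_vadd_mem]
  simp [add_comm]

/-- The covering map from `ℝ^d` to the torus. -/
def toTorus (x : Space d) : UnitAddTorus (Fin d) := fun i => (x i : UnitAddCircle)

/-- The bridge that carries Fourier analysis on the torus to the cell; it is the product of the
one-dimensional maps from [0, 1) to the circle. -/
theorem measurePreserving_toTorus (d : ℕ) : MeasurePreserving (toTorus (d := d)) (cellMeasure d)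
    (Measure.pi fun _ => AddCircle.haarAddCircle) := by
  have h1 : MeasurePreserving (WithLp.ofLp : Space d → Fin d → ℝ) :=
    PiLp.volume_preserving_ofLp (Fin d)
  have hI : MeasurableSet (Set.pi Set.univ fun _ : Fin d => Set.Ico (0 : ℝ) 1) :=
    MeasurableSet.univ_pi fun _ => measurableSet_Ico
  have h2 := h1.restrict_preimage hI
  have h3 : (WithLp.ofLp : Space d → Fin d → ℝ) ⁻¹' (Set.pi Set.univ fun _ => Set.Ico (0 : ℝ) 1)
      = cell d := by
    ext x
    simp [cell]
  rw [h3, volume_pi, Measure.restrict_pi_pi] at h2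
  have h4 : MeasurePreserving (fun x : ℝ => (x : UnitAddCircle)) (volume.restrict (Set.Ico 0 1))
      AddCircle.haarAddCircle := by
    have h := UnitAddCircle.measurePreserving_mk 0
    rw [zero_add, ← restrict_Ico_eq_restrict_Ioc] at h
    convert h
    simp [volume, AddCircle.haarAddCircle]
  exact (measurePreserving_pi (fun _ : Fin d => (volume : Measure ℝ).restrict (Set.Ico 0 1))
    (fun _ => AddCircle.haarAddCircle) fun _ => h4).comp h2

instance isProbabilityMeasure_cellMeasure (d : ℕ) : IsProbabilityMeasure (cellMeasure d) :=
  ⟨by rw [← Set.preimage_univ (f := toTorus (d := d)),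
    (measurePreserving_toTorus d).measure_preimage MeasurableSet.univ.nullMeasurableSet,
    measure_univ]⟩

/-- The cosine mode with frequency `n`. -/
noncomputable def cosMode (n : Fin d → ℤ) (x : Space d) : ℝ :=
  Real.cos (2 * Real.pi * ⟪latticeVec n, x⟫_ℝ)

/-- The sine mode with frequency `n`. -/
noncomputable def sinMode (n : Fin d → ℤ) (x : Space d) : ℝ :=
  Real.sin (2 * Real.pi * ⟪latticeVec n, x⟫_ℝ)

theorem contDiff_cosMode (n : Fin d → ℤ) : ContDiff ℝ ((⊤ : ℕ∞) : WithTop ℕ∞) (cosMode n) := by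
  have h : ContDiff ℝ ((⊤ : ℕ∞) : WithTop ℕ∞) fun x : Space d => ⟪latticeVec n, x⟫_ℝ :=
    (innerSL ℝ (latticeVec n)).contDiff
  exact (contDiff_const.mul h).cos

theorem contDiff_sinMode (n : Fin d → ℤ) : ContDiff ℝ ((⊤ : ℕ∞) : WithTop ℕ∞) (sinMode n) := by
  have h : ContDiff ℝ ((⊤ : ℕ∞) : WithTop ℕ∞) fun x : Space d => ⟪latticeVec n, x⟫_ℝ :=
    (innerSL ℝ (latticeVec n)).contDiff
  exact (contDiff_const.mul h).sin

theorem exists_int_inner_latticeVec (n m : Fin d → ℤ) :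
    ∃ k : ℤ, ⟪latticeVec n, latticeVec m⟫_ℝ = k :=
  ⟨∑ i, n i * m i, by simp [latticeVec, PiLp.inner_apply, mul_comm]⟩

theorem isPeriodic_cosMode (n : Fin d → ℤ) : IsPeriodic (cosMode n) := by
  intro m x
  obtain ⟨k, hk⟩ := exists_int_inner_latticeVec n m
  change Real.cos (2 * Real.pi * ⟪latticeVec n, x + latticeVec m⟫_ℝ) = _
  rw [inner_add_right, hk, mul_add, mul_comm (2 * Real.pi) (k : ℝ), Real.cos_add_int_mul_two_pi]
  rfl

theorem isPeriodic_sinMode (n : Fin d → ℤ) : IsPeriodic (sinMode n) := by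
  intro m x
  obtain ⟨k, hk⟩ := exists_int_inner_latticeVec n m
  change Real.sin (2 * Real.pi * ⟪latticeVec n, x + latticeVec m⟫_ℝ) = _
  rw [inner_add_right, hk, mul_add, mul_comm (2 * Real.pi) (k : ℝ), Real.sin_add_int_mul_two_pi]
  rfl

theorem hasFDerivAt_phase (n : Fin d → ℤ) (x : Space d) :
    HasFDerivAt (fun y : Space d => 2 * Real.pi * ⟪latticeVec n, y⟫_ℝ)
      ((2 * Real.pi) • innerSL ℝ (latticeVec n)) x :=
  ((innerSL ℝ (latticeVec n)).hasFDerivAt).const_mul (2 * Real.pi)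

theorem fderiv_cosMode (n : Fin d → ℤ) (x w : Space d) :
    fderiv ℝ (cosMode n) x w = -(2 * Real.pi * ⟪latticeVec n, w⟫_ℝ) * sinMode n x := by
  have h := (hasFDerivAt_phase n x).cos.fderiv
  change fderiv ℝ (cosMode n) x = _ at h
  rw [h]
  simp [sinMode]
  ring

theorem fderiv_sinMode (n : Fin d → ℤ) (x w : Space d) :
    fderiv ℝ (sinMode n) x w = (2 * Real.pi * ⟪latticeVec n, w⟫_ℝ) * cosMode n x := by
  have h := (hasFDerivAt_phase n x).sin.fderiv
  change fderiv ℝ (sinMode n) x = _ at h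
  rw [h]
  simp [cosMode]
  ring

/-- The cosine Fourier coefficient. -/
noncomputable def cosCoeff (u : Space d → ℝ) (n : Fin d → ℤ) : ℝ :=
  ∫ x, u x * cosMode n x ∂cellMeasure d

/-- The sine Fourier coefficient. -/
noncomputable def sinCoeff (u : Space d → ℝ) (n : Fin d → ℤ) : ℝ :=
  ∫ x, u x * sinMode n x ∂cellMeasure d

theorem mFourier_toTorus (n : Fin d → ℤ) (x : Space d) :
    UnitAddTorus.mFourier n (toTorus x) = (cosMode n x : ℂ) + sinMode n x * Complex.I := by
  have h1 : UnitAddTorus.mFourier n (toTorus x) = ∏ i, fourier (n i) (x i : UnitAddCircle) := rfl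
  rw [h1]
  simp only [fourier_coe_apply]
  rw [← Complex.exp_sum, cosMode, sinMode, Complex.ofReal_cos, Complex.ofReal_sin,
    ← Complex.exp_mul_I]
  congr 1
  simp only [latticeVec, PiLp.inner_apply]
  push_cast
  rw [Finset.mul_sum, Finset.sum_mul]
  refine Finset.sum_congr rfl fun i _ => ?_
  simp
  ring

/-- The covering map has a measurable section with values in the cell; compose u with it. -/
theorem exists_torus_lift {u : Space d → ℝ} (hu : StronglyMeasurable u) :
    ∃ U : UnitAddTorus (Fin d) → ℝ, StronglyMeasurable U ∧
      (fun x => U (toTorus x)) =ᵐ[cellMeasure d] u := by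
  let s : UnitAddTorus (Fin d) → Space d := fun t =>
    WithLp.toLp 2 fun i => (AddCircle.measurableEquivIco 1 0 (t i) : ℝ)
  have hs : Measurable s := by
    refine (MeasurableEquiv.toLp 2 (Fin d → ℝ)).measurable.comp ?_
    refine measurable_pi_lambda _ fun i => ?_
    exact measurable_subtype_coe.comp
      ((AddCircle.measurableEquivIco 1 0).measurable.comp (measurable_pi_apply i))
  refine ⟨u ∘ s, hu.comp_measurable hs, ?_⟩
  refine (ae_restrict_iff' (measurableSet_cell d)).2 (Filter.Eventually.of_forall fun x hx => ?_)
  have : s (toTorus x) = x := by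
    ext i
    have h := AddCircle.equivIco_coe_eq (p := (1 : ℝ)) (a := 0) (x := x i) (by simpa using hx i)
    exact congrArg Subtype.val h
  simp [this]

/-- Parseval's identity on the cell. -/
theorem hasSum_sq_coeff {u : Space d → ℝ} (hu : MemLp u 2 (cellMeasure d)) :
    HasSum (fun n => cosCoeff u n ^ 2 + sinCoeff u n ^ 2) (∫ x, u x ^ 2 ∂cellMeasure d) := by
  obtain ⟨v, hv, huv⟩ := hu.aestronglyMeasurable
  obtain ⟨U, hU, hUv⟩ := exists_torus_lift hv
  have hUu : (fun x => U (toTorus x)) =ᵐ[cellMeasure d] u := hUv.trans huv.symm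
  have hmp := measurePreserving_toTorus d
  let W : UnitAddTorus (Fin d) → ℂ := fun t => (U t : ℂ)
  have hW : MemLp W 2 (Measure.pi fun _ => AddCircle.haarAddCircle) := by
    have h1 : MemLp U 2 (Measure.pi fun _ => AddCircle.haarAddCircle) := by
      have h2 : MemLp (U ∘ toTorus) 2 (cellMeasure d) := hu.ae_eq hUu.symm
      rw [← hmp.map_eq]
      refine (memLp_map_measure_iff ?_ hmp.measurable.aemeasurable).2 h2
      exact hU.aestronglyMeasurable
    exact h1.ofReal
  have hint : ∀ F : UnitAddTorus (Fin d) → ℂ, StronglyMeasurable F →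
      ∫ t, F t ∂(Measure.pi fun _ => AddCircle.haarAddCircle)
        = ∫ x, F (toTorus x) ∂cellMeasure d := by
    intro F hF
    rw [← hmp.map_eq, integral_map hmp.measurable.aemeasurable hF.aestronglyMeasurable]
  have hWm : StronglyMeasurable W := Complex.continuous_ofReal.comp_stronglyMeasurable hU
  have hP := UnitAddTorus.hasSum_sq_mFourierCoeff (hW.toLp W)
  -- Since u is real, its complex coefficient has real part `cosCoeff` and imaginary part
  -- -`sinCoeff`, so the squared modulus is the sum of the two squares.
  have hco : ∀ n : Fin d → ℤ, UnitAddTorus.mFourierCoeff (hW.toLp W) n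
      = (cosCoeff u n : ℂ) - sinCoeff u n * Complex.I := by
    intro n
    have h1 : UnitAddTorus.mFourierCoeff (hW.toLp W) n
        = ∫ t, UnitAddTorus.mFourier (-n) t * W t
          ∂(Measure.pi fun _ => AddCircle.haarAddCircle) := by
      refine integral_congr_ae ?_
      filter_upwards [hW.coeFn_toLp] with t ht
      rw [ht, smul_eq_mul]
    rw [h1, hint (fun t => UnitAddTorus.mFourier (-n) t * W t)
      ((UnitAddTorus.mFourier (-n)).continuous.stronglyMeasurable.mul hWm)]
    have hc : Integrable (fun x => u x * cosMode n x) (cellMeasure d) :=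
      hu.integrable_mul (memLp_of_continuous (contDiff_cosMode n).continuous)
    have hsn : Integrable (fun x => u x * sinMode n x) (cellMeasure d) :=
      hu.integrable_mul (memLp_of_continuous (contDiff_sinMode n).continuous)
    rw [cosCoeff, sinCoeff, ← integral_complex_ofReal, ← integral_complex_ofReal, ← integral_mul_const,
      ← integral_sub hc.ofReal (hsn.ofReal.mul_const _)]
    refine integral_congr_ae ?_
    filter_upwards [hUu] with x hx
    rw [UnitAddTorus.mFourier_neg, mFourier_toTorus]
    simp only [W, hx, map_add, map_mul, Complex.conj_ofReal, Complex.conj_I]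
    push_cast
    ring
  have hnorm : ∫ t, ‖(hW.toLp W) t‖ ^ 2 ∂(Measure.pi fun _ => AddCircle.haarAddCircle)
      = ∫ x, u x ^ 2 ∂cellMeasure d := by
    have h1 : ∫ t, ‖(hW.toLp W) t‖ ^ 2 ∂(Measure.pi fun _ => AddCircle.haarAddCircle)
        = ∫ t, U t ^ 2 ∂(Measure.pi fun _ => AddCircle.haarAddCircle) := by
      refine integral_congr_ae ?_
      filter_upwards [hW.coeFn_toLp] with t ht
      rw [ht]
      simp [W]
    rw [h1, ← hmp.map_eq, integral_map (f := fun t => U t ^ 2)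
      hmp.measurable.aemeasurable (hU.pow 2).aestronglyMeasurable]
    refine integral_congr_ae ?_
    filter_upwards [hUu] with x hx
    rw [hx]
  have hnormc : ∀ a b : ℝ, ‖(a : ℂ) - b * Complex.I‖ ^ 2 = a ^ 2 + b ^ 2 := by
    intro a b
    rw [← Complex.normSq_eq_norm_sq, Complex.normSq_apply]
    simp
    ring
  simp only [hco, hnormc] at hP
  rw [← hnorm]
  exact hP

end Cell

/-! ### Integration by parts for smooth periodic functions -/

section Smooth

variable {d : ℕ}

theorem isPeriodic_fderiv_apply {f : Space d → ℝ} (hp : IsPeriodic f) (w : Space d) :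
    IsPeriodic fun x => fderiv ℝ f x w := by
  intro n x
  have h : (fun y => f (y + WithLp.toLp 2 (fun i => (n i : ℝ)))) = f := funext (hp n)
  have h2 := fderiv_comp_add_right (𝕜 := ℝ) (f := f) (x := x)
    (WithLp.toLp 2 (fun i => (n i : ℝ)))
  rw [h] at h2
  change fderiv ℝ f _ w = fderiv ℝ f x w
  rw [h2]

theorem integrable_of_continuous {f : Space d → ℝ} (hf : Continuous f) :
    Integrable f (cellMeasure d) :=
  (memLp_of_continuous hf).integrable (by norm_num)

/-- The derivative of a smooth periodic function has zero average. -/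
theorem integral_fderiv_eq_zero {f : Space d → ℝ} (hf : ContDiff ℝ ((⊤ : ℕ∞) : WithTop ℕ∞) f)
    (hp : IsPeriodic f) (w : Space d) : ∫ x, fderiv ℝ f x w ∂cellMeasure d = 0 := by
  have hg := continuous_fderiv_test hf w
  -- The average of f(x + w) - f(x) vanishes by translation invariance. Written as an integral of
  -- the derivative over s and exchanged by Fubini, it is also the average of the derivative, since
  -- the average over x does not depend on s.
  have h1 : ∀ x, ∫ s in (0 : ℝ)..1, fderiv ℝ f (x + s • w) w = f (x + w) - f x := by
    intro x
    have hd : ∀ s ∈ Set.uIcc (0 : ℝ) 1,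
        HasDerivAt (fun s : ℝ => f (x + s • w)) (fderiv ℝ f (x + s • w) w) s := by
      intro s _
      have ha : HasDerivAt (fun s : ℝ => x + s • w) w s := by
        simpa using ((hasDerivAt_id s).smul_const w).const_add x
      exact (hf.differentiable (by simp) _).hasFDerivAt.comp_hasDerivAt s ha
    rw [intervalIntegral.integral_eq_sub_of_hasDerivAt hd]
    · simp
    · exact (hg.comp (by fun_prop : Continuous fun s : ℝ => x + s • w)).intervalIntegrable _ _
  have h2 : ∫ x, (∫ s in (0 : ℝ)..1, fderiv ℝ f (x + s • w) w) ∂cellMeasure d = 0 := by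
    simp only [h1]
    rw [integral_sub, setIntegral_cell_add hp w, sub_self]
    · exact integrable_of_continuous (hf.continuous.comp (continuous_add_const w))
    · exact integrable_of_continuous hf.continuous
  simp only [intervalIntegral.integral_of_le zero_le_one] at h2
  rw [integral_integral_swap] at h2
  · simp only [setIntegral_cell_add (isPeriodic_fderiv_apply hp w)] at h2
    simpa using h2
  · rw [cellMeasure, Measure.prod_restrict]
    have hK := (isCompact_box d).prod (isCompact_Icc (a := (0 : ℝ)) (b := 1))
    refine IntegrableOn.mono_set (ContinuousOn.integrableOn_compact hK ?_)
      (Set.prod_mono (cell_subset d) Set.Ioc_subset_Icc_self)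
    exact (hg.comp (by fun_prop : Continuous fun p : Space d × ℝ => p.1 + p.2 • w)).continuousOn

theorem integral_mul_fderiv {f χ : Space d → ℝ} (hf : ContDiff ℝ ((⊤ : ℕ∞) : WithTop ℕ∞) f)
    (hp : IsPeriodic f) (hχ : ContDiff ℝ ((⊤ : ℕ∞) : WithTop ℕ∞) χ) (hχp : IsPeriodic χ)
    (w : Space d) :
    ∫ x, f x * fderiv ℝ χ x w ∂cellMeasure d = -∫ x, fderiv ℝ f x w * χ x ∂cellMeasure d := by
  have h := integral_fderiv_eq_zero (hf.mul hχ) (f := fun x => f x * χ x)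
    (fun n x => congrArg₂ (· * ·) (hp n x) (hχp n x)) w
  have h1 : ∀ x, fderiv ℝ (fun x => f x * χ x) x w
      = f x * fderiv ℝ χ x w + fderiv ℝ f x w * χ x := by
    intro x
    rw [fderiv_fun_mul (hf.differentiable (by simp) x) (hχ.differentiable (by simp) x)]
    simp [mul_comm]
  simp only [h1] at h
  rw [integral_add] at h
  · linarith
  · exact integrable_of_continuous (hf.continuous.mul (continuous_fderiv_test hχ w))
  · exact integrable_of_continuous ((continuous_fderiv_test hf w).mul hχ.continuous)

theorem continuous_gradient {f : Space d → ℝ} (hf : ContDiff ℝ ((⊤ : ℕ∞) : WithTop ℕ∞) f) :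
    Continuous (gradient f) :=
  (InnerProductSpace.toDual ℝ (Space d)).symm.continuous.comp (hf.continuous_fderiv (by simp))

/-- A smooth periodic function as an element of `H¹_per(Q)`. -/
noncomputable def smoothH1 (f : Space d → ℝ) (hf : ContDiff ℝ ((⊤ : ℕ∞) : WithTop ℕ∞) f)
    (hp : IsPeriodic f) : H1per d :=
  ⟨WithLp.toLp 2 ((memLp_of_continuous hf.continuous).toLp f,
    (memLp_of_continuous (continuous_gradient hf)).toLp (gradient f)), by
    intro χ hχ hχp w
    have h1 : ∫ x, (memLp_of_continuous hf.continuous).toLp f x * fderiv ℝ χ x w ∂cellMeasure d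
        = ∫ x, f x * fderiv ℝ χ x w ∂cellMeasure d := by
      refine integral_congr_ae ?_
      filter_upwards [(memLp_of_continuous hf.continuous (d := d)).coeFn_toLp] with x hx
      rw [hx]
    have h2 : ∫ x, ⟪(memLp_of_continuous (continuous_gradient hf)).toLp (gradient f) x, w⟫_ℝ * χ x
        ∂cellMeasure d = ∫ x, fderiv ℝ f x w * χ x ∂cellMeasure d := by
      refine integral_congr_ae ?_
      filter_upwards [(memLp_of_continuous (continuous_gradient hf) (d := d)).coeFn_toLp] with x hx
      rw [hx, gradient, InnerProductSpace.toDual_symm_apply]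
    exact h1.trans ((integral_mul_fderiv hf hp hχ hχp w).trans (congrArg Neg.neg h2.symm))⟩

theorem val_smoothH1 {f : Space d → ℝ} (hf : ContDiff ℝ ((⊤ : ℕ∞) : WithTop ℕ∞) f)
    (hp : IsPeriodic f) : val (smoothH1 f hf hp) =ᵐ[cellMeasure d] f :=
  (memLp_of_continuous hf.continuous).coeFn_toLp

theorem grad_smoothH1 {f : Space d → ℝ} (hf : ContDiff ℝ ((⊤ : ℕ∞) : WithTop ℕ∞) f)
    (hp : IsPeriodic f) : grad (smoothH1 f hf hp) =ᵐ[cellMeasure d] gradient f :=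
  (memLp_of_continuous (continuous_gradient hf)).coeFn_toLp

/-- The constant function `1` in `H¹_per(Q)`. -/
noncomputable def oneH1 (d : ℕ) : H1per d :=
  smoothH1 (fun _ => 1) contDiff_const fun _ _ => rfl

theorem val_oneH1 : val (oneH1 d) =ᵐ[cellMeasure d] fun _ => 1 := val_smoothH1 _ _

theorem grad_oneH1 : grad (oneH1 d) = 0 := by
  refine Lp.ext ?_
  filter_upwards [grad_smoothH1 (d := d) (f := fun _ => 1) contDiff_const fun _ _ => rfl,
    Lp.coeFn_zero (Space d) 2 (cellMeasure d)] with x hx h0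
  rw [oneH1, hx, h0]
  simp [gradient]

theorem latticeVec_inner_self_pos {n : Fin d → ℤ} (hn : n ≠ 0) :
    1 ≤ ‖latticeVec n‖ ^ 2 := by
  rw [EuclideanSpace.norm_sq_eq]
  obtain ⟨i, hi⟩ := Function.ne_iff.1 hn
  have h1 : (1 : ℝ) ≤ ‖latticeVec n i‖ ^ 2 := by
    have : (1 : ℝ) ≤ |(n i : ℝ)| := by exact_mod_cast Int.one_le_abs hi
    simp only [latticeVec, Real.norm_eq_abs]
    nlinarith
  exact h1.trans (Finset.single_le_sum (f := fun i => ‖latticeVec n i‖ ^ 2)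
    (fun _ _ => sq_nonneg _) (Finset.mem_univ i))

/-- The cosine mode is a nonzero multiple of the derivative of the sine mode in the direction of its
own frequency. -/
theorem integral_cosMode {n : Fin d → ℤ} (hn : n ≠ 0) : ∫ x, cosMode n x ∂cellMeasure d = 0 := by
  have h := integral_fderiv_eq_zero (contDiff_sinMode n) (isPeriodic_sinMode n) (latticeVec n)
  simp only [fderiv_sinMode] at h
  rw [integral_const_mul, real_inner_self_eq_norm_sq] at h
  have := latticeVec_inner_self_pos hn
  exact (mul_eq_zero.1 h).resolve_left (by positivity)

theorem integral_sinMode {n : Fin d → ℤ} (hn : n ≠ 0) : ∫ x, sinMode n x ∂cellMeasure d = 0 := by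
  have h := integral_fderiv_eq_zero (contDiff_cosMode n) (isPeriodic_cosMode n) (latticeVec n)
  simp only [fderiv_cosMode] at h
  rw [integral_const_mul, real_inner_self_eq_norm_sq] at h
  have := latticeVec_inner_self_pos hn
  exact (mul_eq_zero.1 h).resolve_left (neg_ne_zero.2 (by positivity))

/-- One integration by parts. Together with its version with n and m exchanged it gives
orthogonality of cosines; with n = m it compares the norms of cosine and sine. -/
theorem integral_cosMode_mul_cosMode (n m : Fin d → ℤ) (w : Space d) :
    ⟪latticeVec m, w⟫_ℝ * ∫ x, cosMode n x * cosMode m x ∂cellMeasure d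
      = ⟪latticeVec n, w⟫_ℝ * ∫ x, sinMode n x * sinMode m x ∂cellMeasure d := by
  have h := integral_mul_fderiv (contDiff_cosMode n) (isPeriodic_cosMode n)
    (contDiff_sinMode m) (isPeriodic_sinMode m) w
  simp only [fderiv_sinMode, fderiv_cosMode, mul_left_comm (cosMode n _), mul_assoc,
    integral_const_mul, neg_mul, integral_neg, neg_neg] at h
  have hpi := Real.pi_pos
  have h2 : (2 * Real.pi) * (⟪latticeVec m, w⟫_ℝ * ∫ x, cosMode n x * cosMode m x ∂cellMeasure d)
      = (2 * Real.pi) *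
        (⟪latticeVec n, w⟫_ℝ * ∫ x, sinMode n x * sinMode m x ∂cellMeasure d) := by
    linarith
  exact mul_left_cancel₀ (by positivity) h2

end Smooth

/-! ### Fourier description of H¹_per(Q), Poincaré and compactness -/

section Sobolev

variable {d : ℕ}

theorem inner_toLp_left {F : Type*} [NormedAddCommGroup F] [InnerProductSpace ℝ F]
    {f : Space d → F} (hf : MemLp f 2 (cellMeasure d)) (u : Lp F 2 (cellMeasure d)) :
    ⟪hf.toLp f, u⟫_ℝ = ∫ x, ⟪f x, u x⟫_ℝ ∂cellMeasure d := by
  rw [L2.inner_def]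
  refine integral_congr_ae ?_
  filter_upwards [hf.coeFn_toLp] with x hx
  rw [hx]

theorem L2_norm_sq (u : L2 d) : ‖u‖ ^ 2 = ∫ x, u x ^ 2 ∂cellMeasure d := by
  rw [← real_inner_self_eq_norm_sq, L2.inner_def]
  refine integral_congr_ae (Filter.Eventually.of_forall fun x => ?_)
  simp [sq]

/-- Each defining condition equates two continuous functionals, namely inner products with fixed L²
elements. -/
theorem isClosed_H1per (d : ℕ) : IsClosed (H1per d : Set (WithLp 2 (L2 d × L2Vec d))) := by
  have h : (H1per d : Set (WithLp 2 (L2 d × L2Vec d)))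
      = {p | ∀ χ : Space d → ℝ, ContDiff ℝ ((⊤ : ℕ∞) : WithTop ℕ∞) χ → IsPeriodic χ →
          ∀ w : Space d, ∫ x, p.fst x * fderiv ℝ χ x w ∂cellMeasure d
            = - ∫ x, ⟪p.snd x, w⟫_ℝ * χ x ∂cellMeasure d} := rfl
  rw [h]
  simp only [Set.ofPred_forall]
  refine isClosed_iInter fun χ => isClosed_iInter fun hχ => isClosed_iInter fun _ =>
    isClosed_iInter fun w => isClosed_eq ?_ (Continuous.neg ?_)
  · have hm := memLp_of_continuous (continuous_fderiv_test hχ w)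
    have h1 : (fun p : WithLp 2 (L2 d × L2Vec d) => ∫ x, p.fst x * fderiv ℝ χ x w ∂cellMeasure d)
        = fun p => ⟪hm.toLp _, p.fst⟫_ℝ := by
      funext p
      rw [inner_toLp_left]
      rfl
    rw [h1]
    exact continuous_const.inner (WithLp.fstL 2 ℝ (L2 d) (L2Vec d)).continuous
  · have hm := memLp_of_continuous (hχ.continuous.smul (continuous_const (y := w)))
    have h1 : (fun p : WithLp 2 (L2 d × L2Vec d) => ∫ x, ⟪p.snd x, w⟫_ℝ * χ x ∂cellMeasure d)
        = fun p => ⟪hm.toLp _, p.snd⟫_ℝ := by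
      funext p
      rw [inner_toLp_left]
      refine integral_congr_ae (Filter.Eventually.of_forall fun x => ?_)
      change _ = ⟪χ x • w, p.snd x⟫_ℝ
      rw [real_inner_smul_left, real_inner_comm, mul_comm]
    rw [h1]
    exact continuous_const.inner (WithLp.sndL 2 ℝ (L2 d) (L2Vec d)).continuous

instance completeSpace_H1per (d : ℕ) : CompleteSpace (H1per d) :=
  (isClosed_H1per d).completeSpace_coe

/-- The map `u ↦ u` from `H¹_per(Q)` to `L²(Q)`. -/
noncomputable def valL (d : ℕ) : H1per d →L[ℝ] L2 d :=
  (WithLp.fstL 2 ℝ (L2 d) (L2Vec d)).comp (H1per d).subtypeL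

/-- The map `u ↦ ∇u` from `H¹_per(Q)` to `L²(Q; ℝ^d)`. -/
noncomputable def gradL (d : ℕ) : H1per d →L[ℝ] L2Vec d :=
  (WithLp.sndL 2 ℝ (L2 d) (L2Vec d)).comp (H1per d).subtypeL

theorem valL_apply (u : H1per d) : valL d u = val u := rfl

theorem H1per_norm_sq (u : H1per d) : ‖u‖ ^ 2 = ‖val u‖ ^ 2 + ‖grad u‖ ^ 2 :=
  WithLp.prod_norm_sq_eq_of_L2 (u : WithLp 2 (L2 d × L2Vec d))

/-- The definition of the weak gradient, tested against one Fourier mode. -/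
theorem cosCoeff_grad (u : H1per d) (w : Space d) (n : Fin d → ℤ) :
    cosCoeff (fun x => ⟪grad u x, w⟫_ℝ) n
      = 2 * Real.pi * ⟪latticeVec n, w⟫_ℝ * sinCoeff (val u) n := by
  have h := u.2 (cosMode n) (contDiff_cosMode n) (isPeriodic_cosMode n) w
  change ∫ x, val u x * _ ∂_ = -∫ x, ⟪grad u x, w⟫_ℝ * _ ∂_ at h
  simp only [fderiv_cosMode, mul_left_comm (val u _), integral_const_mul] at h
  rw [cosCoeff, sinCoeff]
  linarith

theorem sinCoeff_grad (u : H1per d) (w : Space d) (n : Fin d → ℤ) :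
    sinCoeff (fun x => ⟪grad u x, w⟫_ℝ) n
      = -(2 * Real.pi * ⟪latticeVec n, w⟫_ℝ * cosCoeff (val u) n) := by
  have h := u.2 (sinMode n) (contDiff_sinMode n) (isPeriodic_sinMode n) w
  change ∫ x, val u x * _ ∂_ = -∫ x, ⟪grad u x, w⟫_ℝ * _ ∂_ at h
  simp only [fderiv_sinMode, mul_left_comm (val u _), integral_const_mul] at h
  rw [cosCoeff, sinCoeff]
  linarith

theorem hasSum_val (u : L2 d) :
    HasSum (fun n => cosCoeff u n ^ 2 + sinCoeff u n ^ 2) (‖u‖ ^ 2) := by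
  rw [L2_norm_sq]
  exact hasSum_sq_coeff (Lp.memLp u)

/-- Parseval for each component of the gradient; summing over components produces the factor |n|².
-/
theorem hasSum_grad (u : H1per d) :
    HasSum (fun n => (2 * Real.pi) ^ 2 * ‖latticeVec n‖ ^ 2 *
      (cosCoeff (val u) n ^ 2 + sinCoeff (val u) n ^ 2)) (‖grad u‖ ^ 2) := by
  let e : Fin d → Space d := fun i => EuclideanSpace.single i 1
  have hm : ∀ i, MemLp (fun x => ⟪grad u x, e i⟫_ℝ) 2 (cellMeasure d) := fun i =>
    (Lp.memLp (grad u)).inner_const (e i)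
  have h1 : HasSum (fun n => ∑ i, (cosCoeff (fun x => ⟪grad u x, e i⟫_ℝ) n ^ 2
      + sinCoeff (fun x => ⟪grad u x, e i⟫_ℝ) n ^ 2))
      (∑ i, ∫ x, ⟪grad u x, e i⟫_ℝ ^ 2 ∂cellMeasure d) :=
    hasSum_sum fun i _ => hasSum_sq_coeff (hm i)
  have h2 : ‖grad u‖ ^ 2 = ∑ i, ∫ x, ⟪grad u x, e i⟫_ℝ ^ 2 ∂cellMeasure d := by
    rw [← integral_finsetSum _ fun i _ => (hm i).integrable_sq, ← real_inner_self_eq_norm_sq,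
      L2.inner_def]
    refine integral_congr_ae (Filter.Eventually.of_forall fun x => ?_)
    simp only [real_inner_self_eq_norm_sq, EuclideanSpace.norm_sq_eq, e]
    refine Finset.sum_congr rfl fun i _ => ?_
    rw [EuclideanSpace.inner_single_right]
    simp
  rw [h2]
  refine h1.congr_fun fun n => ?_
  simp only [cosCoeff_grad, sinCoeff_grad]
  rw [EuclideanSpace.norm_sq_eq, Finset.mul_sum, Finset.sum_mul]
  refine Finset.sum_congr rfl fun i _ => ?_
  simp only [e, EuclideanSpace.inner_single_right, Real.norm_eq_abs, sq_abs, conj_trivial]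
  ring

/-- A Poincaré inequality for functions without low frequencies. -/
theorem norm_val_le_of_coeff {R : ℝ} (u : H1per d)
    (h : ∀ n, R ≤ ‖latticeVec n‖ ^ 2 ∨ (cosCoeff (val u) n = 0 ∧ sinCoeff (val u) n = 0)) :
    (2 * Real.pi) ^ 2 * R * ‖val u‖ ^ 2 ≤ ‖grad u‖ ^ 2 := by
  refine hasSum_le (fun n => ?_) ((hasSum_val (val u)).mul_left ((2 * Real.pi) ^ 2 * R))
    (hasSum_grad u)
  rcases h n with hn | ⟨h1, h2⟩
  · gcongr
  · simp [h1, h2]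

theorem cosCoeff_zero (u : Space d → ℝ) : cosCoeff u 0 = ∫ x, u x ∂cellMeasure d := by
  have : latticeVec (0 : Fin d → ℤ) = 0 := by
    ext i
    simp [latticeVec]
  simp [cosCoeff, cosMode, this]

theorem sinCoeff_zero (u : Space d → ℝ) : sinCoeff u 0 = 0 := by
  have : latticeVec (0 : Fin d → ℤ) = 0 := by
    ext i
    simp [latticeVec]
  simp [sinCoeff, sinMode, this]

/-- The Poincaré inequality with the sharp constant. -/
theorem poincare (u : H1per d) (hu : ∫ x, val u x ∂cellMeasure d = 0) :
    (2 * Real.pi) ^ 2 * ‖val u‖ ^ 2 ≤ ‖grad u‖ ^ 2 := by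
  have := norm_val_le_of_coeff (R := 1) u fun n => by
    by_cases hn : n = 0
    · right
      rw [hn, cosCoeff_zero, sinCoeff_zero]
      exact ⟨hu, rfl⟩
    · exact Or.inl (latticeVec_inner_self_pos hn)
  linarith

theorem eq_zero_of_coeff_eq_zero (u : L2 d) (hc : ∀ n, cosCoeff u n = 0)
    (hs : ∀ n, sinCoeff u n = 0) : u = 0 := by
  have h := hasSum_val u
  simp only [hc, hs, ne_eq, OfNat.ofNat_ne_zero, not_false_eq_true, zero_pow, add_zero] at h
  have h2 := h.unique hasSum_zero
  exact norm_eq_zero.1 (pow_eq_zero_iff (two_ne_zero)|>.1 h2)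

/-- The Fourier coefficients of the function determine those of its gradient, so the weak gradient
is unique. -/
theorem val_injective : Function.Injective (val (d := d)) := by
  intro u v huv
  have h0 : valL d (u - v) = 0 := by
    rw [map_sub]
    exact sub_eq_zero.2 huv
  have h1 : val (u - v) = 0 := h0
  have h2 := hasSum_grad (u - v)
  have h3 := hasSum_val (val (u - v))
  rw [h1, norm_zero, zero_pow two_ne_zero,
    hasSum_zero_iff_of_nonneg (fun n => add_nonneg (sq_nonneg _) (sq_nonneg _))] at h3
  have h4 : ∀ n, cosCoeff (val (u - v)) n ^ 2 + sinCoeff (val (u - v)) n ^ 2 = 0 := fun n => by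
    rw [h1]
    exact congrFun h3 n
  simp only [h4, mul_zero] at h2
  have h5 := h2.unique hasSum_zero
  have h6 := H1per_norm_sq (u - v)
  rw [h1, h5, norm_zero, zero_pow two_ne_zero, add_zero] at h6
  exact sub_eq_zero.1 (norm_eq_zero.1 (pow_eq_zero_iff two_ne_zero|>.1 h6))

/-- Rellich's theorem by Fourier truncation: once the finitely many modes with all |n i| ≤ N are
removed, Poincaré improves to N ‖u‖ ≤ ‖∇u‖, and 1/N < ε. -/
theorem isCompactOperator_valL (d : ℕ) : IsCompactOperator (valL d) := by
  classical
  refine isCompactOperator_of_forall_exists_finite _ fun ε hε => ?_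
  obtain ⟨N, hN⟩ := exists_nat_gt (1 / ε)
  let s : Finset (Fin d → ℤ) := Fintype.piFinset fun _ => Finset.Icc (-(N : ℤ)) N
  let c : (Fin d → ℤ) → L2 d := fun n =>
    (memLp_of_continuous (contDiff_cosMode n).continuous).toLp (cosMode n)
  let t : (Fin d → ℤ) → L2 d := fun n =>
    (memLp_of_continuous (contDiff_sinMode n).continuous).toLp (sinMode n)
  refine ⟨s.image c ∪ s.image t, fun u hu => ?_⟩
  have hNpos : (0 : ℝ) < N := lt_trans (by positivity) hN
  have h1 := norm_val_le_of_coeff (R := (N : ℝ) ^ 2) u fun n => by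
    by_cases hn : n ∈ s
    · right
      constructor
      · have := hu (c n) (Finset.mem_union_left _ (Finset.mem_image_of_mem _ hn))
        rw [inner_toLp_left] at this
        exact this
      · have := hu (t n) (Finset.mem_union_right _ (Finset.mem_image_of_mem _ hn))
        rw [inner_toLp_left] at this
        exact this
    · left
      simp only [s, Fintype.mem_piFinset, Finset.mem_Icc, not_forall] at hn
      obtain ⟨i, hi⟩ := hn
      have h2 : (N : ℤ) < |n i| := by
        rw [← not_le, abs_le]
        exact hi
      have h3 : (N : ℝ) < |(n i : ℝ)| := by exact_mod_cast h2
      rw [EuclideanSpace.norm_sq_eq]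
      refine le_trans ?_ (Finset.single_le_sum (f := fun i => ‖latticeVec n i‖ ^ 2)
        (fun _ _ => sq_nonneg _) (Finset.mem_univ i))
      simp only [latticeVec, Real.norm_eq_abs]
      gcongr
  have h2 := H1per_norm_sq u
  have hpi : (1 : ℝ) ≤ (2 * Real.pi) ^ 2 := by nlinarith [Real.pi_gt_three]
  have h3 : (N : ℝ) ^ 2 * ‖val u‖ ^ 2 ≤ ‖u‖ ^ 2 := by
    have h4 : (N : ℝ) ^ 2 * ‖val u‖ ^ 2 ≤ (2 * Real.pi) ^ 2 * ((N : ℝ) ^ 2 * ‖val u‖ ^ 2) :=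
      le_mul_of_one_le_left (by positivity) hpi
    nlinarith [sq_nonneg ‖val u‖]
  rw [← mul_pow] at h3
  have h5 : N * ‖val u‖ ≤ ‖u‖ := le_of_sq_le_sq h3 (norm_nonneg _)
  rw [div_lt_iff₀ hε] at hN
  rw [valL_apply]
  nlinarith [norm_nonneg u, norm_nonneg (val u), mul_le_mul_of_nonneg_left h5 hε.le]

end Sobolev

/-! ### The Dirichlet form and the weak formulations on zero-average functions -/

section Energy

variable {d : ℕ}

theorem inner_val_oneH1 (u : L2 d) : ⟪val (oneH1 d), u⟫_ℝ = ∫ x, u x ∂cellMeasure d := by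
  rw [L2.inner_def]
  refine integral_congr_ae ?_
  filter_upwards [val_oneH1 (d := d)] with x hx
  rw [hx]
  simp

/-- The subspace of `H¹_per(Q)` of the functions with zero average. -/
noncomputable def H0 (d : ℕ) : Submodule ℝ (WithLp 2 (L2 d × L2Vec d)) :=
  H1per d ⊓ LinearMap.ker (((innerSL ℝ (val (oneH1 d))).comp (WithLp.fstL 2 ℝ (L2 d) (L2Vec d)) :
    WithLp 2 (L2 d × L2Vec d) →L[ℝ] ℝ) : WithLp 2 (L2 d × L2Vec d) →ₗ[ℝ] ℝ)

instance completeSpace_H0 (d : ℕ) : CompleteSpace (H0 d) :=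
  ((isClosed_H1per d).inter (ContinuousLinearMap.isClosed_ker
    ((innerSL ℝ (val (oneH1 d))).comp
      (WithLp.fstL 2 ℝ (L2 d) (L2Vec d))))).completeSpace_coe

/-- The inclusion of the functions with zero average into `H¹_per(Q)`. -/
noncomputable def inclL (d : ℕ) : H0 d →L[ℝ] H1per d :=
  (H0 d).subtypeL.codRestrict (H1per d) fun u => u.2.1

theorem inclL_injective : Function.Injective (inclL d) := fun _ _ h =>
  Subtype.ext (congrArg (fun w : H1per d => (w : WithLp 2 (L2 d × L2Vec d))) h)

theorem norm_inclL (u : H0 d) : ‖inclL d u‖ = ‖u‖ := rfl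

theorem integral_val_inclL (u : H0 d) : ∫ x, val (inclL d u) x ∂cellMeasure d = 0 := by
  rw [← inner_val_oneH1]
  exact u.2.2

theorem exists_inclL_eq {u : H1per d} (h : ∫ x, val u x ∂cellMeasure d = 0) :
    ∃ v : H0 d, inclL d v = u := by
  rw [← inner_val_oneH1] at h
  exact ⟨⟨u, u.2, h⟩, rfl⟩

/-- Reduces tests against all of H¹_per(Q) to zero-average tests, since constants have zero
gradient. -/
theorem exists_add_smul_oneH1 (u : H1per d) :
    ∃ (v : H0 d) (c : ℝ), u = inclL d v + c • oneH1 d := by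
  have h1 : ∫ x, val (oneH1 d) x ∂cellMeasure d = 1 := by
    rw [integral_congr_ae val_oneH1]
    simp
  obtain ⟨v, hv⟩ := exists_inclL_eq (u := u - (∫ x, val u x ∂cellMeasure d) • oneH1 d) (by
    rw [← inner_val_oneH1, ← valL_apply (u - _), map_sub, map_smul, inner_sub_right,
      real_inner_smul_right, valL_apply, valL_apply, inner_val_oneH1, inner_val_oneH1, h1, mul_one,
      sub_self])
  exact ⟨v, _, by rw [hv, sub_add_cancel]⟩

variable {A : Space d → Matrix (Fin d) (Fin d) ℝ} {α β : ℝ}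

theorem continuous_act :
    Continuous (act : Matrix (Fin d) (Fin d) ℝ → Space d →L[ℝ] Space d) := by
  let f : Matrix (Fin d) (Fin d) ℝ →ₗ[ℝ] (Space d →L[ℝ] Space d) :=
    { toFun := act
      map_add' := fun M N => map_add (Matrix.toEuclideanCLM (n := Fin d) (𝕜 := ℝ)) M N
      map_smul' := fun c M => map_smul (Matrix.toEuclideanCLM (n := Fin d) (𝕜 := ℝ)) c M }
  have h : Continuous f := LinearMap.continuous_of_finiteDimensional f
  exact h

theorem PeriodicHom.IsPeriodicDiffusion.continuous_act (hA : IsPeriodicDiffusion A α β) :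
    Continuous fun x => act (A x) :=
  _root_.continuous_act.comp hA.uniformContinuous.continuous

theorem aestronglyMeasurable_clm_apply {F : Space d → Space d →L[ℝ] Space d} (hF : Continuous F)
    (f : L2Vec d) : AEStronglyMeasurable (fun x => F x (f x)) (cellMeasure d) := by
  have hc : Continuous fun p : (Space d →L[ℝ] Space d) × Space d => p.1 p.2 :=
    continuous_fst.clm_apply continuous_snd
  have h1 : AEStronglyMeasurable f (cellMeasure d) := Lp.aestronglyMeasurable f
  have h2 : AEStronglyMeasurable F (cellMeasure d) := hF.aestronglyMeasurable
  exact hc.comp_aestronglyMeasurable (h2.prodMk h1)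

theorem PeriodicHom.IsPeriodicDiffusion.memLp_act_apply (hA : IsPeriodicDiffusion A α β)
    (f : L2Vec d) : MemLp (fun x => act (A x) (f x)) 2 (cellMeasure d) := by
  refine MemLp.of_le_mul (c := β) (Lp.memLp f)
    (aestronglyMeasurable_clm_apply hA.continuous_act f) ?_
  filter_upwards [hA.bounded] with x hx
  exact hx _

/-- Multiplication by a coefficient field on `L²(Q; ℝ^d)`. -/
noncomputable def coeffMul (hA : IsPeriodicDiffusion A α β) : L2Vec d →L[ℝ] L2Vec d :=
  LinearMap.mkContinuous
    { toFun := fun f => (hA.memLp_act_apply f).toLp _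
      map_add' := fun f g => by
        refine Lp.ext ?_
        filter_upwards [(hA.memLp_act_apply (f + g)).coeFn_toLp, (hA.memLp_act_apply f).coeFn_toLp, (hA.memLp_act_apply g).coeFn_toLp,
          Lp.coeFn_add f g, Lp.coeFn_add ((hA.memLp_act_apply f).toLp _) ((hA.memLp_act_apply g).toLp _)] with x h1 h2 h3 h4 h5
        rw [h1, h5, Pi.add_apply, h2, h3, h4, Pi.add_apply, map_add]
      map_smul' := fun c f => by
        refine Lp.ext ?_
        filter_upwards [(hA.memLp_act_apply (c • f)).coeFn_toLp, (hA.memLp_act_apply f).coeFn_toLp,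
          Lp.coeFn_smul c f, Lp.coeFn_smul c ((hA.memLp_act_apply f).toLp _)] with x h1 h2 h4 h5
        rw [h1, RingHom.id_apply, h5, Pi.smul_apply, h2, h4, Pi.smul_apply, map_smul] } β
    (fun f => by
      refine Lp.norm_le_mul_norm_of_ae_le_mul ?_
      filter_upwards [(hA.memLp_act_apply f).coeFn_toLp, hA.bounded] with x h1 h2
      change ‖(hA.memLp_act_apply f).toLp _ x‖ ≤ _
      rw [h1]
      exact h2 _)

theorem coeffMul_ae_eq (hA : IsPeriodicDiffusion A α β) (f : L2Vec d) :
    coeffMul hA f =ᵐ[cellMeasure d] fun x => act (A x) (f x) :=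
  (hA.memLp_act_apply f).coeFn_toLp

theorem inner_coeffMul (hA : IsPeriodicDiffusion A α β) (f g : L2Vec d) :
    ⟪g, coeffMul hA f⟫_ℝ = ∫ x, ⟪g x, act (A x) (f x)⟫_ℝ ∂cellMeasure d := by
  rw [L2.inner_def]
  refine integral_congr_ae ?_
  filter_upwards [coeffMul_ae_eq hA f] with x hx
  rw [hx]

theorem inner_coeffMul_comm (hA : IsPeriodicDiffusion A α β) (f g : L2Vec d) :
    ⟪g, coeffMul hA f⟫_ℝ = ⟪f, coeffMul hA g⟫_ℝ := by
  rw [inner_coeffMul, inner_coeffMul]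
  refine integral_congr_ae (Filter.Eventually.of_forall fun x => ?_)
  exact inner_act_comm (hA.symm x) _ _

theorem le_inner_coeffMul (hA : IsPeriodicDiffusion A α β) (f : L2Vec d) :
    α * ‖f‖ ^ 2 ≤ ⟪f, coeffMul hA f⟫_ℝ := by
  have hint := L2.integrable_inner (𝕜 := ℝ) f (coeffMul hA f)
  rw [← real_inner_self_eq_norm_sq, L2.inner_def, L2.inner_def, ← integral_const_mul]
  refine integral_mono_ae ((L2.integrable_inner (𝕜 := ℝ) f f).const_mul α) hint ?_
  filter_upwards [coeffMul_ae_eq hA f, hA.coercive] with x h1 h2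
  simp only [h1, real_inner_self_eq_norm_sq]
  exact h2 _

/-- The Dirichlet form `∫_Q ∇v · A∇u` on `H¹_per(Q)`. -/
noncomputable def energyForm (hA : IsPeriodicDiffusion A α β) : H1per d →L[ℝ] H1per d →L[ℝ] ℝ :=
  LinearMap.mkContinuous₂ (LinearMap.mk₂ ℝ (fun u v => ⟪gradL d v, coeffMul hA (gradL d u)⟫_ℝ)
    (fun u u' v => by simp only [map_add, inner_add_right])
    (fun c u v => by simp only [map_smul, real_inner_smul_right, smul_eq_mul])
    (fun u v v' => by simp only [map_add, inner_add_left])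
    (fun c u v => by simp only [map_smul, real_inner_smul_left, smul_eq_mul]))
    (‖coeffMul hA‖) (fun u v => by
      have hg : ∀ w : H1per d, ‖gradL d w‖ ≤ ‖w‖ := fun w => by
        refine le_of_sq_le_sq ?_ (norm_nonneg _)
        rw [H1per_norm_sq]
        exact le_add_of_nonneg_left (sq_nonneg ‖val w‖)
      change |⟪gradL d v, coeffMul hA (gradL d u)⟫_ℝ| ≤ _
      refine (abs_real_inner_le_norm _ _).trans ?_
      calc ‖gradL d v‖ * ‖coeffMul hA (gradL d u)‖
          ≤ ‖v‖ * (‖coeffMul hA‖ * ‖u‖) := by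
            gcongr
            · exact hg v
            · exact (ContinuousLinearMap.le_opNorm _ _).trans (by gcongr; exact hg u)
        _ = _ := by ring)

theorem energyForm_apply (hA : IsPeriodicDiffusion A α β) (u v : H1per d) :
    energyForm hA u v = ⟪grad v, coeffMul hA (grad u)⟫_ℝ := rfl

theorem energyForm_eq_integral (hA : IsPeriodicDiffusion A α β) (u v : H1per d) :
    energyForm hA u v = ∫ x, ⟪grad v x, act (A x) (grad u x)⟫_ℝ ∂cellMeasure d :=
  inner_coeffMul hA _ _

theorem energyForm_comm (hA : IsPeriodicDiffusion A α β) (u v : H1per d) :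
    energyForm hA u v = energyForm hA v u :=
  inner_coeffMul_comm hA _ _

theorem le_energyForm (hA : IsPeriodicDiffusion A α β) (u : H1per d) :
    α * ‖grad u‖ ^ 2 ≤ energyForm hA u u :=
  le_inner_coeffMul hA _

theorem energyForm_oneH1 (hA : IsPeriodicDiffusion A α β) (u : H1per d) :
    energyForm hA u (oneH1 d) = 0 := by
  rw [energyForm_apply, grad_oneH1, inner_zero_left]

/-- The Dirichlet form on the functions with zero average. -/
noncomputable def energyForm0 (hA : IsPeriodicDiffusion A α β) : H0 d →L[ℝ] H0 d →L[ℝ] ℝ :=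
  (energyForm hA).bilinearComp (inclL d) (inclL d)

theorem energyForm0_apply (hA : IsPeriodicDiffusion A α β) (u v : H0 d) :
    energyForm0 hA u v = energyForm hA (inclL d u) (inclL d v) := rfl

theorem isCoercive_energyForm0 (hA : IsPeriodicDiffusion A α β) : IsCoercive (energyForm0 hA) := by
  -- As (2π)² ≥ 1, Poincaré gives ‖u‖² ≤ 2 ‖∇u‖², whence the constant α / 2.
  refine ⟨α / 2, half_pos hA.alpha_pos, fun u => ?_⟩
  have h1 := le_energyForm hA (inclL d u)
  have h2 := poincare (inclL d u) (integral_val_inclL u)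
  have h3 := H1per_norm_sq (inclL d u)
  have hpi : (1 : ℝ) ≤ (2 * Real.pi) ^ 2 := by nlinarith [Real.pi_gt_three]
  have h4 : ‖val (inclL d u)‖ ^ 2 ≤ (2 * Real.pi) ^ 2 * ‖val (inclL d u)‖ ^ 2 :=
    le_mul_of_one_le_left (sq_nonneg _) hpi
  rw [energyForm0_apply, mul_assoc, ← sq, ← norm_inclL]
  have := hA.alpha_pos
  nlinarith

/-- The map `u ↦ u` from the functions with zero average to `L²(Q)`. -/
noncomputable def val0 (d : ℕ) : H0 d →L[ℝ] L2 d := (valL d).comp (inclL d)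

theorem val0_apply (u : H0 d) : val0 d u = val (inclL d u) := rfl

theorem val0_injective : Function.Injective (val0 d) :=
  val_injective.comp inclL_injective

theorem isCompactOperator_val0 : IsCompactOperator (val0 d) :=
  (isCompactOperator_valL d).comp_clm (inclL d)

theorem localDrift_eq (hA : IsPeriodicDiffusion A α β) (ξ : Space d) (v : H1per d) :
    localDrift hA ξ v = -⟪(memLp_act hA ξ).toLp _, grad v⟫_ℝ := rfl

theorem localDrift_oneH1 (hA : IsPeriodicDiffusion A α β) (ξ : Space d) :
    localDrift hA ξ (oneH1 d) = 0 := by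
  rw [localDrift_eq, grad_oneH1, inner_zero_right, neg_zero]

theorem localDrift_add (hA : IsPeriodicDiffusion A α β) (ξ η : Space d) (v : H1per d) :
    localDrift hA (ξ + η) v = localDrift hA ξ v + localDrift hA η v := by
  have : (memLp_act hA (ξ + η)).toLp _ = (memLp_act hA ξ).toLp _ + (memLp_act hA η).toLp _ := by
    rw [← MemLp.toLp_add]
    exact MemLp.toLp_congr _ _ (Filter.Eventually.of_forall fun x => map_add _ _ _)
  rw [localDrift_eq, this, inner_add_left, neg_add]
  rfl

theorem localDrift_smul (hA : IsPeriodicDiffusion A α β) (c : ℝ) (ξ : Space d) (v : H1per d) :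
    localDrift hA (c • ξ) v = c * localDrift hA ξ v := by
  have : (memLp_act hA (c • ξ)).toLp _ = c • (memLp_act hA ξ).toLp _ := by
    rw [← MemLp.toLp_const_smul]
    exact MemLp.toLp_congr _ _ (Filter.Eventually.of_forall fun x => map_smul _ _ _)
  rw [localDrift_eq, this, real_inner_smul_left, ← mul_neg]
  rfl

theorem integral_inner_const_add (hA : IsPeriodicDiffusion A α β) (ξ : Space d) (g : L2Vec d)
    (f : L2Vec d) :
    ∫ x, ⟪g x, act (A x) (ξ + f x)⟫_ℝ ∂cellMeasure d
      = ⟪(memLp_act hA ξ).toLp _, g⟫_ℝ + ⟪g, coeffMul hA f⟫_ℝ := by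
  rw [real_inner_comm, ← inner_add_right, L2.inner_def]
  refine integral_congr_ae ?_
  filter_upwards [(memLp_act hA ξ).coeFn_toLp, coeffMul_ae_eq hA f,
    Lp.coeFn_add ((memLp_act hA ξ).toLp _) (coeffMul hA f)] with x h1 h2 h3
  rw [h3, Pi.add_apply, h1, h2, map_add]

theorem isCorrector_iff (hA : IsPeriodicDiffusion A α β) (ξ : Space d) (φ : H1per d) :
    IsCorrector A ξ φ ↔ (∫ x, val φ x ∂cellMeasure d = 0) ∧ ∀ v : H0 d, energyForm hA φ (inclL d v)
      = localDrift hA ξ (inclL d v) := by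
  have key : ∀ v : H1per d, ∫ x, ⟪grad v x, act (A x) (ξ + grad φ x)⟫_ℝ ∂cellMeasure d
      = energyForm hA φ v - localDrift hA ξ v := by
    intro v
    rw [integral_inner_const_add hA, localDrift_eq, energyForm_apply]
    ring
  rw [IsCorrector]
  refine and_congr_right fun _ => ⟨fun h v => ?_, fun h v => ?_⟩
  · have := h (inclL d v)
    rw [key] at this
    linarith
  · rw [key]
    obtain ⟨v0, c, rfl⟩ := exists_add_smul_oneH1 v
    simp only [map_add, map_smul, energyForm_oneH1, localDrift_oneH1, h v0]
    simp

/-- The zero average of f is the compatibility condition that makes the equation hold for constant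
test functions. -/
theorem isInverseImage_iff (hA : IsPeriodicDiffusion A α β) {f : L2 d}
    (hf : ∫ x, f x ∂cellMeasure d = 0) (u : H1per d) :
    IsInverseImage A f u ↔ (∫ x, val u x ∂cellMeasure d = 0) ∧ ∀ v : H0 d, energyForm hA u (inclL d v)
      = ⟪f, val0 d v⟫_ℝ := by
  have key : ∀ v : H1per d, ∫ x, f x * val v x ∂cellMeasure d = ⟪f, val v⟫_ℝ := by
    intro v
    rw [L2.inner_def]
    refine integral_congr_ae (Filter.Eventually.of_forall fun x => ?_)
    simp [mul_comm]
  rw [IsInverseImage]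
  simp only [← energyForm_eq_integral hA, key]
  refine and_congr_right fun _ => ⟨fun h v => h (inclL d v), fun h v => ?_⟩
  obtain ⟨v0, c, rfl⟩ := exists_add_smul_oneH1 v
  rw [← valL_apply, map_add, map_add, map_smul, map_smul, energyForm_oneH1, h v0, inner_add_right,
    real_inner_smul_right, valL_apply, valL_apply, real_inner_comm (val (oneH1 d)), inner_val_oneH1,
    hf]
  simp [val0_apply]

end Energy

/-! ### Existence of the eigenbasis, the corrector and the homogenized matrix -/

section Eigen

variable {d : ℕ}

/-- By duality: a y orthogonal to all zero-average modes has no nonzero frequency, so it is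
constant, hence orthogonal to every f of zero average. -/
theorem mem_closure_range_val0 (f : L2 d) :
    f ∈ (LinearMap.range (val0 d : H0 d →ₗ[ℝ] L2 d)).topologicalClosure ↔
      ∫ x, f x ∂cellMeasure d = 0 := by
  constructor
  · intro hf
    have hle : (LinearMap.range (val0 d : H0 d →ₗ[ℝ] L2 d)).topologicalClosure
        ≤ LinearMap.ker (innerSL ℝ (val (oneH1 d)) : L2 d →ₗ[ℝ] ℝ) := by
      refine Submodule.topologicalClosure_minimal _ ?_ (ContinuousLinearMap.isClosed_ker _)
      rintro _ ⟨u, rfl⟩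
      change ⟪val (oneH1 d), val (inclL d u)⟫_ℝ = 0
      rw [inner_val_oneH1, integral_val_inclL]
    rw [← inner_val_oneH1]
    exact hle hf
  · intro hf
    refine Submodule.mem_closure_of_forall_inner_eq_zero fun y hy => ?_
    let c : ℝ := ∫ x, y x ∂cellMeasure d
    have hz : y - c • val (oneH1 d) = 0 := by
      have hco : ∀ (χ : Space d → ℝ) (hχ : ContDiff ℝ ((⊤ : ℕ∞) : WithTop ℕ∞) χ),
          ∫ x, (y - c • val (oneH1 d)) x * χ x ∂cellMeasure d
            = ∫ x, y x * χ x ∂cellMeasure d - c * ∫ x, χ x ∂cellMeasure d := by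
        intro χ hχ
        rw [← integral_const_mul, ← integral_sub (integrable_mul_test _ hχ.continuous)
          ((integrable_of_continuous hχ.continuous).const_mul c)]
        refine integral_congr_ae ?_
        filter_upwards [Lp.coeFn_sub y (c • val (oneH1 d)), Lp.coeFn_smul c (val (oneH1 d)),
          val_oneH1 (d := d)] with x h1 h2 h3
        rw [h1, Pi.sub_apply, h2, Pi.smul_apply, h3, smul_eq_mul]
        ring
      have horth : ∀ (χ : Space d → ℝ) (hχ : ContDiff ℝ ((⊤ : ℕ∞) : WithTop ℕ∞) χ)
          (hp : IsPeriodic χ), ∫ x, χ x ∂cellMeasure d = 0 →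
          ∫ x, y x * χ x ∂cellMeasure d = 0 := by
        intro χ hχ hp h0
        obtain ⟨v, hv⟩ := exists_inclL_eq (u := smoothH1 χ hχ hp) (by
          rw [integral_congr_ae (val_smoothH1 hχ hp), h0])
        have h1 := hy _ ⟨v, rfl⟩
        change ⟪val (inclL d v), y⟫_ℝ = 0 at h1
        rw [hv] at h1
        have h2 : ⟪val (smoothH1 χ hχ hp), y⟫_ℝ = ∫ x, ⟪χ x, y x⟫_ℝ ∂cellMeasure d :=
          inner_toLp_left (memLp_of_continuous hχ.continuous) y
        rw [← h1, h2]
        rfl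
      refine eq_zero_of_coeff_eq_zero _ (fun n => ?_) (fun n => ?_)
      · by_cases hn : n = 0
        · rw [hn, cosCoeff_zero]
          have h1 := hco (fun _ => 1) contDiff_const
          simp only [mul_one] at h1
          rw [h1]
          simp [c]
        · rw [cosCoeff, hco _ (contDiff_cosMode n), integral_cosMode hn,
            horth _ (contDiff_cosMode n) (isPeriodic_cosMode n) (integral_cosMode hn)]
          ring
      · by_cases hn : n = 0
        · rw [hn, sinCoeff_zero]
        · rw [sinCoeff, hco _ (contDiff_sinMode n), integral_sinMode hn,
            horth _ (contDiff_sinMode n) (isPeriodic_sinMode n) (integral_sinMode hn)]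
          ring
    rw [sub_eq_zero.1 hz, real_inner_smul_right, real_inner_comm, inner_val_oneH1, hf, mul_zero]

/-- The cosines of frequencies 1, 2, 3, … in one coordinate direction are orthogonal and nonzero. -/
theorem not_finiteDimensional_H0 (hd : 1 ≤ d) : ¬ FiniteDimensional ℝ (H0 d) := by
  intro hfd
  classical
  let i0 : Fin d := ⟨0, hd⟩
  -- The shift by 1 avoids frequency zero, whose mode does not have zero average.
  let n : ℕ → (Fin d → ℤ) := fun k => Pi.single i0 ((k : ℤ) + 1)
  have hn : ∀ k, n k ≠ 0 := fun k h => by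
    have := congrFun h i0
    simp only [n, Pi.single_eq_same, Pi.zero_apply] at this
    omega
  let w : Space d := EuclideanSpace.single i0 1
  have hw : ∀ k, ⟪latticeVec (n k), w⟫_ℝ = k + 1 := fun k => by
    simp only [w]
    rw [EuclideanSpace.inner_single_right]
    simp [latticeVec, n]
  have hex : ∀ k, ∃ v : H0 d,
      inclL d v = smoothH1 _ (contDiff_cosMode (n k)) (isPeriodic_cosMode (n k)) := fun k =>
    exists_inclL_eq (by rw [integral_congr_ae (val_smoothH1 _ _), integral_cosMode (hn k)])
  choose v hv using hex
  have hin : ∀ k l, ⟪val0 d (v k), val0 d (v l)⟫_ℝ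
      = ∫ x, cosMode (n k) x * cosMode (n l) x ∂cellMeasure d := by
    intro k l
    rw [val0_apply, val0_apply, hv, hv, L2.inner_def]
    refine integral_congr_ae ?_
    filter_upwards [val_smoothH1 (contDiff_cosMode (n k)) (isPeriodic_cosMode (n k)),
      val_smoothH1 (contDiff_cosMode (n l)) (isPeriodic_cosMode (n l))] with x h1 h2
    rw [h1, h2]
    simp [mul_comm]
  have horth : ∀ k l, k ≠ l → ⟪val0 d (v k), val0 d (v l)⟫_ℝ = 0 := by
    intro k l hkl
    rw [hin]
    have h1 := integral_cosMode_mul_cosMode (n k) (n l) w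
    have h2 := integral_cosMode_mul_cosMode (n l) (n k) w
    simp only [mul_comm (cosMode (n l) _), mul_comm (sinMode (n l) _), hw] at h1 h2
    have h3 : ((l + 1 : ℝ) ^ 2 - (k + 1) ^ 2)
        * ∫ x, cosMode (n k) x * cosMode (n l) x ∂cellMeasure d = 0 := by
      linear_combination (l + 1 : ℝ) * h1 - (k + 1 : ℝ) * h2
    refine (mul_eq_zero.1 h3).resolve_left fun h4 => hkl ?_
    have h5 : (l + 1 : ℝ) = k + 1 :=
      (sq_eq_sq₀ (by positivity) (by positivity)).1 (sub_eq_zero.1 h4)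
    exact_mod_cast (add_right_cancel h5).symm
  have hne : ∀ k, val0 d (v k) ≠ 0 := by
    intro k h0
    have h1 := hin k k
    rw [h0, inner_zero_left] at h1
    have h2 := integral_cosMode_mul_cosMode (n k) (n k) w
    rw [← h1, hw, mul_zero] at h2
    -- If the cosine had zero norm, so would the sine, against cos² + sin² = 1.
    have h3 : ∫ x, sinMode (n k) x * sinMode (n k) x ∂cellMeasure d = 0 :=
      (mul_eq_zero.1 h2.symm).resolve_left (by positivity)
    have h4 : ∫ x, (cosMode (n k) x * cosMode (n k) x + sinMode (n k) x * sinMode (n k) x)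
        ∂cellMeasure d = 1 := by
      have : ∀ x : Space d, cosMode (n k) x * cosMode (n k) x
          + sinMode (n k) x * sinMode (n k) x = 1 := fun x => by
        rw [← sq, ← sq]
        exact Real.cos_sq_add_sin_sq _
      simp only [this]
      simp
    rw [integral_add, ← h1, h3] at h4
    · norm_num at h4
    · exact integrable_of_continuous
        ((contDiff_cosMode _).continuous.mul (contDiff_cosMode _).continuous)
    · exact integrable_of_continuous
        ((contDiff_sinMode _).continuous.mul (contDiff_sinMode _).continuous)
  have hli : LinearIndependent ℝ (fun k => val0 d (v k)) :=
    linearIndependent_of_ne_zero_of_inner_eq_zero hne fun k l hkl => horth k l hkl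
  have hli2 : LinearIndependent ℝ v := LinearIndependent.of_comp (val0 d : H0 d →ₗ[ℝ] L2 d) hli
  have := hli2.finite_of_isNoetherian
  exact not_finite ℕ

variable {A : Space d → Matrix (Fin d) (Fin d) ℝ} {α β : ℝ}

theorem nonempty_eigenBasis (hd : 1 ≤ d) (hA : IsPeriodicDiffusion A α β) :
    Nonempty (EigenBasis A) := by
  have : Fact ((2 : ENNReal) ≠ ⊤) := ⟨by norm_num⟩
  obtain ⟨ψ, l, hl, ho, hcl, hψ⟩ := exists_eigenbasis (isCoercive_energyForm0 hA)
    (fun u v => energyForm_comm hA _ _) (val0 d) val0_injective isCompactOperator_val0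
    (not_finiteDimensional_H0 hd)
  refine ⟨⟨fun i => inclL d (ψ i), l, hl, ho, fun f => ?_, fun i => ?_⟩⟩
  · have h1 : (Submodule.span ℝ (Set.range fun i => val (inclL d (ψ i)))).topologicalClosure
        = (LinearMap.range (val0 d : H0 d →ₗ[ℝ] L2 d)).topologicalClosure := hcl
    rw [h1, mem_closure_range_val0]
  · rw [isInverseImage_iff hA (integral_val_inclL _), ← map_smul]
    refine ⟨integral_val_inclL _, fun v => ?_⟩
    have := hψ i v
    rw [map_smul, map_smul, smul_apply, ← energyForm0_apply, this, smul_eq_mul,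
      inv_mul_cancel_left₀ (hl i).ne']
    rfl

theorem exists_corrector (hA : IsPeriodicDiffusion A α β) (ξ : Space d) :
    ∃ φ : H0 d, ∀ v : H0 d, energyForm0 hA φ v = localDrift hA ξ (inclL d v) :=
  (isCoercive_energyForm0 hA).exists_solution ((localDrift hA ξ).comp (inclL d))

/-- The corrector in direction `ξ`. -/
noncomputable def corrector (hA : IsPeriodicDiffusion A α β) (ξ : Space d) : H0 d :=
  (exists_corrector hA ξ).choose

theorem energyForm0_corrector (hA : IsPeriodicDiffusion A α β) (ξ : Space d) (v : H0 d) :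
    energyForm0 hA (corrector hA ξ) v = localDrift hA ξ (inclL d v) :=
  (exists_corrector hA ξ).choose_spec v

theorem isCorrector_iff_eq (hA : IsPeriodicDiffusion A α β) (ξ : Space d) (φ : H1per d) :
    IsCorrector A ξ φ ↔ φ = inclL d (corrector hA ξ) := by
  rw [isCorrector_iff hA]
  constructor
  · rintro ⟨h0, h⟩
    obtain ⟨u, rfl⟩ := exists_inclL_eq h0
    congr 1
    refine (isCoercive_energyForm0 hA).eq_of_forall_eq fun v => ?_
    rw [energyForm0_corrector, ← h v, energyForm0_apply]
  · rintro rfl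
    exact ⟨integral_val_inclL _, energyForm0_corrector hA ξ⟩

theorem integral_inner_act_comm (hA : IsPeriodicDiffusion A α β) (ξ η : Space d) :
    ∫ x, ⟪ξ, act (A x) η⟫_ℝ ∂cellMeasure d = ∫ x, ⟪η, act (A x) ξ⟫_ℝ ∂cellMeasure d :=
  integral_congr_ae (Filter.Eventually.of_forall fun x => inner_act_comm (hA.symm x) _ _)

theorem integrable_inner_act (hA : IsPeriodicDiffusion A α β) (ξ η : Space d) :
    Integrable (fun x => ⟪ξ, act (A x) η⟫_ℝ) (cellMeasure d) :=
  integrable_of_continuous (continuous_const.inner (hA.continuous_act.clm_apply continuous_const))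

theorem integral_inner_act_add (hA : IsPeriodicDiffusion A α β) (ξ ξ' η : Space d) :
    ∫ x, ⟪ξ + ξ', act (A x) η⟫_ℝ ∂cellMeasure d
      = ∫ x, ⟪ξ, act (A x) η⟫_ℝ ∂cellMeasure d + ∫ x, ⟪ξ', act (A x) η⟫_ℝ ∂cellMeasure d := by
  simp only [inner_add_left]
  exact integral_add (integrable_inner_act hA ξ η) (integrable_inner_act hA ξ' η)

theorem integral_inner_act_smul (c : ℝ) (ξ η : Space d) :
    ∫ x, ⟪c • ξ, act (A x) η⟫_ℝ ∂cellMeasure d = c * ∫ x, ⟪ξ, act (A x) η⟫_ℝ ∂cellMeasure d := by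
  simp only [real_inner_smul_left]
  exact integral_const_mul _ _

/-- Each of the two cross terms contributes -⟨𝔡, φ⟩, and the equation tested with φ makes the
quadratic term +⟨𝔡, φ⟩. -/
theorem integral_corrector_energy (hA : IsPeriodicDiffusion A α β) (ξ : Space d) :
    ∫ x, ⟪ξ + grad (inclL d (corrector hA ξ)) x,
        act (A x) (ξ + grad (inclL d (corrector hA ξ)) x)⟫_ℝ ∂cellMeasure d
      = ∫ x, ⟪ξ, act (A x) ξ⟫_ℝ ∂cellMeasure d
        - localDrift hA ξ (inclL d (corrector hA ξ)) := by
  set φ := inclL d (corrector hA ξ)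
  let c : L2Vec d := (memLp_of_continuous (continuous_const (y := ξ))).toLp _
  have hc : c =ᵐ[cellMeasure d] fun _ => ξ := MemLp.coeFn_toLp _
  have h1 : ∫ x, ⟪ξ + grad φ x, act (A x) (ξ + grad φ x)⟫_ℝ ∂cellMeasure d
      = ∫ x, ⟪(c + grad φ) x, act (A x) ((c + grad φ) x)⟫_ℝ ∂cellMeasure d := by
    refine integral_congr_ae ?_
    filter_upwards [hc, Lp.coeFn_add c (grad φ)] with x h1 h2
    rw [h2, Pi.add_apply, h1]
  have h2 : ⟪c, coeffMul hA c⟫_ℝ = ∫ x, ⟪ξ, act (A x) ξ⟫_ℝ ∂cellMeasure d := by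
    rw [inner_coeffMul]
    refine integral_congr_ae ?_
    filter_upwards [hc] with x h1
    rw [h1]
  have h3 : coeffMul hA c = (memLp_act hA ξ).toLp _ := by
    refine Lp.ext ?_
    filter_upwards [coeffMul_ae_eq hA c, hc, (memLp_act hA ξ).coeFn_toLp] with x h1 h2 h3
    rw [h1, h2, h3]
  have h4 : ⟪grad φ, coeffMul hA c⟫_ℝ = - localDrift hA ξ φ := by
    rw [h3, localDrift_eq, neg_neg, real_inner_comm]
  have h5 : ⟪grad φ, coeffMul hA (grad φ)⟫_ℝ = localDrift hA ξ φ :=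
    energyForm0_corrector hA ξ (corrector hA ξ)
  rw [h1, ← inner_coeffMul hA, map_add, inner_add_left, inner_add_right, inner_add_right,
    inner_coeffMul_comm hA (grad φ) c, h2, h4, h5]
  ring

theorem localDrift_corrector_comm (hA : IsPeriodicDiffusion A α β) (ξ η : Space d) :
    localDrift hA ξ (inclL d (corrector hA η)) = localDrift hA η (inclL d (corrector hA ξ)) := by
  rw [← energyForm0_corrector, ← energyForm0_corrector]
  exact energyForm_comm hA _ _

theorem isHomogenizedMatrix_iff (hA : IsPeriodicDiffusion A α β)
    (M : Matrix (Fin d) (Fin d) ℝ) :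
    IsHomogenizedMatrix A M ↔ M.IsSymm ∧ ∀ ξ : Space d, ⟪ξ, act M ξ⟫_ℝ
      = ∫ x, ⟪ξ, act (A x) ξ⟫_ℝ ∂cellMeasure d
        - localDrift hA ξ (inclL d (corrector hA ξ)) := by
  refine and_congr_right fun _ => forall_congr' fun ξ => ?_
  simp only [isCorrector_iff_eq hA, existsUnique_eq, forall_eq, true_and,
    integral_corrector_energy hA]

theorem existsUnique_homogenizedMatrix (hA : IsPeriodicDiffusion A α β) :
    ∃! Ahom, IsHomogenizedMatrix A Ahom := by
  simp only [isHomogenizedMatrix_iff hA]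
  obtain ⟨M, hM, hb⟩ := exists_symm_matrix
    (fun ξ η => ∫ x, ⟪ξ, act (A x) η⟫_ℝ ∂cellMeasure d
        - localDrift hA ξ (inclL d (corrector hA η)))
    (fun ξ η => by rw [integral_inner_act_comm hA, localDrift_corrector_comm])
    (fun ξ ξ' η => by rw [integral_inner_act_add hA, localDrift_add]; ring)
    (fun c ξ η => by rw [integral_inner_act_smul, localDrift_smul]; ring)
  exact ⟨M, ⟨hM, hb⟩, fun N hN => symm_ext hN.1 hM fun ξ => by rw [hN.2, hb]⟩

end Eigen

/-! ### Spectral formulas, the approximate matrix and its error -/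

section Approximation

variable {d : ℕ} {A : Space d → Matrix (Fin d) (Fin d) ℝ} {α β : ℝ}

theorem PeriodicHom.EigenBasis.integral_val_psi (S : EigenBasis A) (i : ℕ) :
    ∫ x, val (S.psi i) x ∂cellMeasure d = 0 :=
  (S.complete _).1 (Submodule.le_topologicalClosure _ (Submodule.subset_span ⟨i, rfl⟩))

theorem PeriodicHom.EigenBasis.energyForm_psi (hA : IsPeriodicDiffusion A α β) (S : EigenBasis A)
    (i : ℕ) (v : H0 d) :
    energyForm hA (S.psi i) (inclL d v) = S.eigenvalue i * ⟪val (S.psi i), val0 d v⟫_ℝ := by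
  have h := ((isInverseImage_iff hA (S.integral_val_psi i) _).1 (S.eigen i)).2 v
  rw [map_smul, smul_apply, smul_eq_mul] at h
  rw [← h, mul_inv_cancel_left₀ (S.eigenvalue_pos i).ne']

theorem PeriodicHom.EigenBasis.exists_psi_eq (S : EigenBasis A) :
    ∃ ψ : ℕ → H0 d, ∀ i, inclL d (ψ i) = S.psi i := by
  choose ψ hψ using fun i => exists_inclL_eq (S.integral_val_psi i)
  exact ⟨ψ, hψ⟩

/-- The spectral gap. -/
theorem PeriodicHom.EigenBasis.le_eigenvalue (hA : IsPeriodicDiffusion A α β) (S : EigenBasis A)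
    (i : ℕ) : 4 * α * Real.pi ^ 2 ≤ S.eigenvalue i := by
  obtain ⟨ψ, hψ⟩ := S.exists_psi_eq
  have hnorm : ‖val (S.psi i)‖ = 1 := S.orthonormal.1 i
  -- Testing the eigenvalue equation with the normalized ψ_i itself shows that λ_i is its energy.
  have h1 := S.energyForm_psi hA i (ψ i)
  rw [val0_apply, hψ, real_inner_self_eq_norm_sq, hnorm, one_pow, mul_one] at h1
  have h2 := le_energyForm hA (S.psi i)
  have h3 := poincare (S.psi i) (S.integral_val_psi i)
  rw [hnorm] at h3
  rw [h1] at h2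
  have := mul_le_mul_of_nonneg_left h3 hA.alpha_pos.le
  linarith

/-- The drift, continuous on H¹_per(Q), is applied to the eigenfunction expansion of the corrector.
The form with two directions also serves to build the bilinear form behind the approximate matrix.
-/
theorem PeriodicHom.EigenBasis.hasSum_localDrift (hA : IsPeriodicDiffusion A α β)
    (S : EigenBasis A) (ξ η : Space d) :
    HasSum (fun i => (S.eigenvalue i)⁻¹ * (localDrift hA ξ (S.psi i) * localDrift hA η (S.psi i)))
      (localDrift hA ξ (inclL d (corrector hA η))) := by
  obtain ⟨ψ, hψ⟩ := S.exists_psi_eq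
  have hval : (fun i => val0 d (ψ i)) = fun i => val (S.psi i) := by
    funext i
    rw [val0_apply, hψ]
  have h := hasSum_eigenbasis (isCoercive_energyForm0 hA) (fun u v => energyForm_comm hA _ _)
    (val0 d) val0_injective (ψ := ψ) S.eigenvalue_pos (by rw [hval]; exact S.orthonormal)
    (fun v => by rw [hval]; exact (S.complete _).2 (integral_val_inclL v))
    (fun i v => by rw [energyForm0_apply, hψ, S.energyForm_psi hA, val0_apply (ψ i), hψ])
    (corrector hA η)
  have h2 := ((localDrift hA ξ).comp (inclL d)).hasSum h
  refine h2.congr_fun fun i => ?_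
  simp only [ContinuousLinearMap.comp_apply, map_smul, energyForm0_corrector, hψ, smul_eq_mul]
  ring

/-- The spectral multiplier of the approximation, as a function of the eigenvalue. -/
theorem P_div_prodPoly {k : ℕ} {μ l : ℝ} (hμ : 0 < μ) (hl : 0 < l) :
    (P k μ).eval l / (prodPoly k μ).eval l
      = l⁻¹ * (1 - 2 ^ (k * (k - 1)) * μ ^ (2 * k) / (prodPoly k μ).eval l) := by
  have hpos : 0 < (prodPoly k μ).eval l := by
    rw [prodPoly_eval]
    exact Finset.prod_pos fun j _ => by positivity
  rw [P_eval hl.ne', ← prodPoly_eval]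
  field_simp

theorem remainder_nonneg {k : ℕ} {μ l : ℝ} (hμ : 0 < μ) (hl : 0 < l) :
    0 ≤ 2 ^ (k * (k - 1)) * μ ^ (2 * k) / (prodPoly k μ).eval l := by
  rw [prodPoly_eval]
  exact div_nonneg (by positivity) (Finset.prod_nonneg fun j _ => by positivity)

/-- The numerator is the product evaluated at λ = 0 (`prod_eval_zero`), and every factor increases
with λ. -/
theorem remainder_le_one {k : ℕ} {μ l : ℝ} (hμ : 0 < μ) (hl : 0 < l) :
    2 ^ (k * (k - 1)) * μ ^ (2 * k) / (prodPoly k μ).eval l ≤ 1 := by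
  rw [prodPoly_eval]
  refine div_le_one_of_le₀ ?_ (Finset.prod_nonneg fun j _ => by positivity)
  rw [← prod_eval_zero]
  exact Finset.prod_le_prod (fun j _ => by positivity) fun j _ => by gcongr

/-- Each factor satisfies 2^j μ + l ≥ l ≥ c; here c stands for the spectral gap. -/
theorem remainder_le {k : ℕ} {μ l c : ℝ} (hμ : 0 < μ) (hc : 0 < c) (hl : c ≤ l) :
    2 ^ (k * (k - 1)) * μ ^ (2 * k) / (prodPoly k μ).eval l
      ≤ 2 ^ (k * (k - 1)) * (1 / c) ^ (2 * k) * μ ^ (2 * k) := by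
  have hl0 : 0 < l := hc.trans_le hl
  have h1 : c ^ (2 * k) ≤ (prodPoly k μ).eval l := by
    rw [prodPoly_eval, pow_mul, ← Finset.card_range k, ← Finset.prod_const, Finset.card_range]
    refine Finset.prod_le_prod (fun j _ => by positivity) fun j _ => ?_
    gcongr
    have : 0 ≤ 2 ^ j * μ := by positivity
    linarith
  calc _ ≤ 2 ^ (k * (k - 1)) * μ ^ (2 * k) / c ^ (2 * k) := by gcongr
    _ = _ := by
      rw [one_div, inv_pow]
      ring

theorem abs_multiplier_le {k : ℕ} {μ l : ℝ} (hμ : 0 < μ) (hl : 0 < l) :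
    |(P k μ).eval l / (prodPoly k μ).eval l| ≤ l⁻¹ := by
  have h0 := remainder_nonneg (k := k) hμ hl
  have h1 := remainder_le_one (k := k) hμ hl
  rw [P_div_prodPoly hμ hl, abs_of_nonneg (mul_nonneg (by positivity) (by linarith))]
  exact mul_le_of_le_one_right (by positivity) (by linarith)

/-- The multiplier is dominated by λ⁻¹, for which the series converges by the corrector expansion.
-/
theorem PeriodicHom.EigenBasis.summable_multiplier (hA : IsPeriodicDiffusion A α β)
    (S : EigenBasis A) (k : ℕ) {μ : ℝ} (hμ : 0 < μ) (ξ η : Space d) :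
    Summable fun i => (P k μ).eval (S.eigenvalue i) / (prodPoly k μ).eval (S.eigenvalue i)
      * (localDrift hA ξ (S.psi i) * localDrift hA η (S.psi i)) := by
  refine Summable.of_norm_bounded (g := fun i => |(S.eigenvalue i)⁻¹ *
    (localDrift hA ξ (S.psi i) * localDrift hA η (S.psi i))|)
    (S.hasSum_localDrift hA ξ η).summable.abs fun i => ?_
  rw [Real.norm_eq_abs, abs_mul, abs_mul (S.eigenvalue i)⁻¹,
    abs_of_pos (inv_pos.2 (S.eigenvalue_pos i))]
  gcongr
  exact abs_multiplier_le hμ (S.eigenvalue_pos i)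

theorem PeriodicHom.EigenBasis.integrable_multiplier (hA : IsPeriodicDiffusion A α β)
    (S : EigenBasis A) (k : ℕ) {μ : ℝ} (hμ : 0 < μ) (ξ : Space d) :
    Integrable (fun l => (P k μ).eval l / (prodPoly k μ).eval l)
      (S.spectralMeasure (localDrift hA ξ)) := by
  refine integrable_sum_dirac (fun i => ENNReal.ofReal_ne_top) ?_
  refine (S.summable_multiplier hA k hμ ξ ξ).abs.congr fun i => ?_
  rw [ENNReal.toReal_ofReal (sq_nonneg _), abs_mul, abs_mul_self, Real.norm_eq_abs]
  ring

theorem PeriodicHom.EigenBasis.integral_multiplier (hA : IsPeriodicDiffusion A α β)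
    (S : EigenBasis A) (k : ℕ) (μ : ℝ) (ξ : Space d) :
    ∫ l, (P k μ).eval l / (prodPoly k μ).eval l ∂S.spectralMeasure (localDrift hA ξ)
      = ∑' i, (P k μ).eval (S.eigenvalue i) / (prodPoly k μ).eval (S.eigenvalue i)
        * (localDrift hA ξ (S.psi i) * localDrift hA ξ (S.psi i)) := by
  refine (integral_sum_dirac fun i => ENNReal.ofReal_ne_top).trans (tsum_congr fun i => ?_)
  rw [ENNReal.toReal_ofReal (sq_nonneg _), smul_eq_mul]
  ring

theorem PeriodicHom.EigenBasis.isApproxMatrix_iff (hA : IsPeriodicDiffusion A α β)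
    (S : EigenBasis A) (k : ℕ) {μ : ℝ} (hμ : 0 < μ) (M : Matrix (Fin d) (Fin d) ℝ) :
    IsApproxMatrix hA S k μ M ↔ M.IsSymm ∧ ∀ ξ : Space d, ⟪ξ, act M ξ⟫_ℝ
      = (∫ x, ⟪ξ, act (A x) ξ⟫_ℝ ∂cellMeasure d)
        - ∑' i, (P k μ).eval (S.eigenvalue i) / (prodPoly k μ).eval (S.eigenvalue i)
          * (localDrift hA ξ (S.psi i) * localDrift hA ξ (S.psi i)) := by
  refine and_congr_right fun _ => forall_congr' fun ξ => ?_
  rw [and_iff_right (S.integrable_multiplier hA k hμ ξ), S.integral_multiplier hA]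

theorem PeriodicHom.EigenBasis.existsUnique_approxMatrix (hA : IsPeriodicDiffusion A α β)
    (S : EigenBasis A) (k : ℕ) {μ : ℝ} (hμ : 0 < μ) :
    ∃! Amuk, IsApproxMatrix hA S k μ Amuk := by
  simp only [S.isApproxMatrix_iff hA k hμ]
  obtain ⟨M, hM, hb⟩ := exists_symm_matrix
    (fun ξ η => (∫ x, ⟪ξ, act (A x) η⟫_ℝ ∂cellMeasure d)
      - ∑' i, (P k μ).eval (S.eigenvalue i) / (prodPoly k μ).eval (S.eigenvalue i)
          * (localDrift hA ξ (S.psi i) * localDrift hA η (S.psi i)))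
    (fun ξ η => by
      rw [integral_inner_act_comm hA]
      simp only [mul_comm (localDrift hA ξ _)])
    (fun ξ ξ' η => by
      have h := (S.summable_multiplier hA k hμ ξ η).tsum_add (S.summable_multiplier hA k hμ ξ' η)
      rw [integral_inner_act_add hA]
      simp only [localDrift_add, add_mul, mul_add]
      linarith)
    (fun c ξ η => by
      rw [integral_inner_act_smul, mul_sub, ← tsum_mul_left]
      simp only [localDrift_smul, mul_assoc, mul_left_comm _ c])
  exact ⟨M, ⟨hM, hb⟩, fun N hN => symm_ext hN.1 hM fun ξ => by rw [hN.2, hb]⟩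

/-- Coercivity and Cauchy–Schwarz give α‖∇φ‖² ≤ ⟨𝔡, φ⟩ ≤ ‖Aξ‖ ‖∇φ‖; eliminating ‖∇φ‖ leaves α⟨𝔡, φ⟩
≤ ‖Aξ‖². -/
theorem localDrift_corrector_le (hA : IsPeriodicDiffusion A α β) {ξ : Space d} (hξ : ‖ξ‖ = 1) :
    localDrift hA ξ (inclL d (corrector hA ξ))
      ≤ α⁻¹ * ∫ x, ‖act (A x)‖ ^ 2 ∂cellMeasure d := by
  set φ := inclL d (corrector hA ξ) with hφ
  set a : L2Vec d := (memLp_act hA ξ).toLp _ with ha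
  have hα := hA.alpha_pos
  have h1 : α * ‖grad φ‖ ^ 2 ≤ localDrift hA ξ φ := by
    rw [hφ, ← energyForm0_corrector]
    exact le_energyForm hA _
  have h2 : localDrift hA ξ φ ≤ ‖a‖ * ‖grad φ‖ := by
    rw [localDrift_eq]
    exact (neg_le_abs _).trans (abs_real_inner_le_norm _ _)
  have h3 : ‖a‖ ^ 2 ≤ ∫ x, ‖act (A x)‖ ^ 2 ∂cellMeasure d := by
    rw [← real_inner_self_eq_norm_sq, L2.inner_def]
    refine integral_mono_ae (L2.integrable_inner (𝕜 := ℝ) a a)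
      (integrable_of_continuous (hA.continuous_act.norm.pow 2)) ?_
    filter_upwards [(memLp_act hA ξ).coeFn_toLp] with x hx
    rw [real_inner_self_eq_norm_sq, hx]
    gcongr
    simpa [hξ] using (act (A x)).le_opNorm ξ
  have h4 : α * localDrift hA ξ φ ≤ ‖a‖ ^ 2 := by
    nlinarith [sq_nonneg (‖a‖ - α * ‖grad φ‖), norm_nonneg a, norm_nonneg (grad φ),
      mul_le_mul_of_nonneg_left h1 hα.le, mul_le_mul_of_nonneg_left h2 hα.le]
  rw [inv_mul_eq_div, le_div_iff₀ hα, mul_comm]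
  exact h4.trans h3

/-- The averages ⟨ξ·Aξ⟩ cancel, and so do the λ⁻¹ parts of the two series; only the remainder r(λ)
survives. -/
theorem PeriodicHom.EigenBasis.hasSum_error (hA : IsPeriodicDiffusion A α β) (S : EigenBasis A)
    (k : ℕ) {μ : ℝ} (hμ : 0 < μ) {Ahom Amuk : Matrix (Fin d) (Fin d) ℝ}
    (h1 : IsHomogenizedMatrix A Ahom) (h2 : IsApproxMatrix hA S k μ Amuk) (ξ : Space d) :
    HasSum (fun i => 2 ^ (k * (k - 1)) * μ ^ (2 * k) / (prodPoly k μ).eval (S.eigenvalue i) *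
      ((S.eigenvalue i)⁻¹ * (localDrift hA ξ (S.psi i) * localDrift hA ξ (S.psi i))))
      ⟪ξ, act (Amuk - Ahom) ξ⟫_ℝ := by
  have h := (S.hasSum_localDrift hA ξ ξ).sub (S.summable_multiplier hA k hμ ξ ξ).hasSum
  have hval : ⟪ξ, act (Amuk - Ahom) ξ⟫_ℝ = localDrift hA ξ (inclL d (corrector hA ξ))
      - ∑' i, (P k μ).eval (S.eigenvalue i) / (prodPoly k μ).eval (S.eigenvalue i)
          * (localDrift hA ξ (S.psi i) * localDrift hA ξ (S.psi i)) := by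
    rw [act_sub, sub_apply, inner_sub_right, ((S.isApproxMatrix_iff hA k hμ _).1 h2).2,
      ((isHomogenizedMatrix_iff hA _).1 h1).2]
    ring
  rw [hval]
  refine h.congr_fun fun i => ?_
  rw [P_div_prodPoly hμ (S.eigenvalue_pos i)]
  ring

end Approximation

/-! ### The error estimate -/

theorem mainTheorem3 {d : ℕ} (hd : 1 ≤ d) (A : Space d → Matrix (Fin d) (Fin d) ℝ) (α β : ℝ)
    (hA : IsPeriodicDiffusion A α β) :
    (∃! Ahom, IsHomogenizedMatrix A Ahom) ∧
    Nonempty (EigenBasis A) ∧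
    ∀ (S : EigenBasis A) (k : ℕ) (μ : ℝ), 0 < μ →
      (∃! Amuk, IsApproxMatrix hA S k μ Amuk) ∧
      ∀ Ahom Amuk : Matrix (Fin d) (Fin d) ℝ,
        IsHomogenizedMatrix A Ahom → IsApproxMatrix hA S k μ Amuk →
        ∀ ξ : Space d, ‖ξ‖ = 1 →
          0 ≤ ⟪ξ, act (Amuk - Ahom) ξ⟫_ℝ ∧
          ⟪ξ, act (Amuk - Ahom) ξ⟫_ℝ ≤
            2 ^ (k * (k - 1)) * (α⁻¹ * ∫ x, ‖act (A x)‖ ^ 2 ∂cellMeasure d)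
              * (1 / (4 * α * Real.pi ^ 2)) ^ (2 * k) * μ ^ (2 * k) := by
  refine ⟨existsUnique_homogenizedMatrix hA, nonempty_eigenBasis hd hA, fun S k μ hμ =>
    ⟨S.existsUnique_approxMatrix hA k hμ, fun Ahom Amuk h1 h2 ξ hξ => ?_⟩⟩
  have hα := hA.alpha_pos
  have hpi := Real.pi_pos
  have herr := S.hasSum_error hA k hμ h1 h2 ξ
  have hsum := S.hasSum_localDrift hA ξ ξ
  have hterm : ∀ i, 0 ≤ (S.eigenvalue i)⁻¹ *
      (localDrift hA ξ (S.psi i) * localDrift hA ξ (S.psi i)) := fun i =>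
    mul_nonneg (inv_pos.2 (S.eigenvalue_pos i)).le (mul_self_nonneg _)
  refine ⟨herr.nonneg fun i =>
    mul_nonneg (remainder_nonneg hμ (S.eigenvalue_pos i)) (hterm i), ?_⟩
  -- The remainder is bounded uniformly with c = 4απ²; the series that is left sums to ⟨𝔡, φ⟩.
  have hle := hasSum_le (fun i => mul_le_mul_of_nonneg_right
    (remainder_le (k := k) hμ (by positivity) (S.le_eigenvalue hA i)) (hterm i)) herr
    (hsum.mul_left _)
  refine hle.trans ((mul_le_mul_of_nonneg_left (localDrift_corrector_le hA hξ)
    (by positivity)).trans_eq ?_)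
  ring
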